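/- **Setting.** Let $\Theta\subset\mathbb R^d$ be a compact domain without boundary in the following sense: there is a countable group $\Gamma$ of isometries of $\mathbb R^d$ such that $\Theta$ is a bounded Borel set and every $x\in\mathbb R^d$ is mapped into $\Theta$ by exactly one element of $\Gamma$; points of $\mathbb R^d$ are identified along $\Gamma$, so that $\Theta$ represents the closed flat manifold $\mathbb R^d/\Gamma$ (for example $\Theta=[-\pi,\pi)^d$ with opposite faces identified, the flat torus), and functions on $\Theta$ are $\Gamma$-invariant functions on $\mathbb R^d$. The operators $\nabla$, $\nabla\cdot$ and the measure $d\theta$ are the Euclidean ones. Let $V,V':\Theta\to\mathbb R$ be $C^2$ and put $\pi=e^{-V}/\int_\Theta e^{-V}d\theta$, $\pi'=e^{-V'}/\int_\Theta e^{-V'}d\theta$. Let $T>0$ and let $\rho,\rho'$ be strictly positive classical ($C^{1,2}$) solutions on $[0,T]\times\Theta$ of $$\partial_t\rho_t=\nabla\cdot(\nabla\rho_t+\rho_t\nabla V)-\alpha_t\rho_t,\qquad \alpha_t=\log\frac{\rho_t}{\pi}-\int_\Theta\log\frac{\rho_t}{\pi}\,\rho_t\,d\theta,$$ $$\partial_t\rho'_t=\nabla\cdot(\nabla\rho'_t+\rho'_t\nabla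 V')-\alpha'_t\rho'_t,\qquad \alpha'_t=\log\frac{\rho'_t}{\pi'}-\int_\Theta\log\frac{\rho'_t}{\pi'}\,\rho'_t\,d\theta,$$ with a common initial probability density $\rho_0=\rho'_0$. Here $C^{1,2}$ means: $C^1$ in $t$ for fixed $\theta$, $C^2$ in $\theta$ for fixed $t$, with $\rho$ and $\partial_t\rho$ continuous on $[0,T]\times\Theta$. Let $H(t)=\mathrm{KL}(\rho_t\|\rho'_t)=\int_\Theta\log(\rho_t/\rho'_t)\,\rho_t\,d\theta$. **Assumptions.** $\sup_\Theta\|\nabla V-\nabla V'\|\le\Delta_{\rm gradpot}$. There is $\lambda_{\rm Gibbs}>0$ such that for each $\mu\in\{\pi,\pi'\}$ and every $C^\infty$ function $f$ on $\Theta$ with $\int_\Theta f^2d\mu=1$, $\int_\Theta f^2\log f^2\,d\mu\le\frac{2}{\lambda_{\rm Gibbs}}\int_\Theta\|\nabla f\|^2d\mu$. With $R_0=\max_\Theta\log\frac{\rho_0}{\pi}-\min_\Theta\log\frac{\rho_0}{\pi}$ and $R_0'=\max_\Theta\log\frac{\rho_0}{\pi'}-\min_\Theta\log\frac{\rho_0}{\pi'}$,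 one has $R_0,R_0'\le B$ for some $B\ge0$. The constant $S_{\rm tar}$ satisfies $|\log(\pi/\pi')|\le S_{\rm tar}$ on $\Theta$. **Conclusion.** $H$ is differentiable on $[0,T]$ (one-sidedly at the end points), and for every $c\in(0,1)$ and every $t\in[0,T]$ the following hold. (i) $H'(t)\le-2(1-c)e^{-e^{-t}B}\lambda_{\rm Gibbs}H(t)+b_c(t)$, where $b_c(t)=\frac{1}{4c}\Delta_{\rm gradpot}^2+\frac{(R_0')^2}{16}e^{-2t}+\frac12S_{\rm tar}R_0e^{-t}+2R_0'e^{-t}$. (ii) $H(t)\le\int_0^t\exp\!\Big(-2(1-c)\lambda_{\rm Gibbs}\int_s^te^{-e^{-u}B}du\Big)b_c(s)\,ds$. (iii) With $A_1=\frac{\Delta_{\rm gradpot}^2}{4c}$, $A_2=B\big(\frac{S_{\rm tar}}2+2\big)$, $A_3=\frac{B^2}{16}$ and $\kappa=2(1-c)e^{-B}\lambda_{\rm Gibbs}$, $$H(t)\le\begin{cases}A_1\frac{1-e^{-\kappa t}}{\kappa}+A_2\frac{e^{-t}-e^{-\kappa t}}{\kappa-1}+A_3\frac{e^{-2t}-e^{-\kappa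 t}}{\kappa-2},&\kappa\ne1,2,\\[2pt]A_1\frac{1-e^{-\kappa t}}{\kappa}+A_2\,te^{-t}+A_3\frac{e^{-2t}-e^{-\kappa t}}{\kappa-2},&\kappa=1,\\[2pt]A_1\frac{1-e^{-\kappa t}}{\kappa}+A_2\frac{e^{-t}-e^{-\kappa t}}{\kappa-1}+A_3\,te^{-2t},&\kappa=2.\end{cases}$$ Moreover, if $\sup_\Theta|V-V'|\le\Delta_{\rm pot}$, then $S_{\rm tar}=2\Delta_{\rm pot}$ is admissible; and if $\sup_\Theta(V-V')-\inf_\Theta(V-V')\le\Delta_{\rm pot,osc}$, then $S_{\rm tar}=\Delta_{\rm pot,osc}$ is admissible. (No constant depends on $T$, so for solutions on $[0,\infty)$ all bounds hold for every $t\ge0$.) -/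

import Mathlib

open MeasureTheory Set

noncomputable section

namespace SHK

/-- The ambient Euclidean space `ℝ^d`. -/
abbrev E (d : ℕ) : Type := EuclideanSpace ℝ (Fin d)

/-- `Θ ⊆ ℝ^d` is a compact domain without boundary, in the sense that points of `ℝ^d` are identified
along a countable group `Γ` of Euclidean isometries, `Θ` is a bounded Borel set, and every point of
`ℝ^d` is carried into `Θ` by exactly one element of `Γ`. So `Θ` is a set of representatives of the
quotient `ℝ^d / Γ`, which is a closed manifold (compact, without boundary) on which
gradient, divergence and Lebesgue measure are the Euclidean ones: the uniqueness says that the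
action is free, the translates of `Θ` are disjoint sets of the same positive
volume, so only finitely many of them meet a given bounded set (proper discontinuity), and
boundedness gives compactness. The half-open box `[-π, π)^d`, with `Γ` the translations by
`2πℤ^d`, is the flat torus. Functions on the quotient are `Γ`-invariant functions on `ℝ^d`. -/
structure IsClosedFlatDomain {d : ℕ} (Γ : Subgroup (E d ≃ᵢ E d)) (Θ : Set (E d)) : Prop where
  countable : Countable Γ
  measurableSet : MeasurableSet Θ
  isBounded : Bornology.IsBounded Θ
  existsUnique : ∀ x : E d, ∃! γ : Γ, (γ : E d ≃ᵢ E d) x ∈ Θ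

/-- `f` is (the lift to `ℝ^d` of) a function on `ℝ^d / Γ`. -/
def IsInvariant {d : ℕ} (Γ : Subgroup (E d ≃ᵢ E d)) (f : E d → ℝ) : Prop :=
  ∀ γ ∈ Γ, ∀ x, f (γ x) = f x

/-- The divergence `∇ · F = ∑ i, ∂ᵢ Fᵢ` of a vector field. -/
def divergence {d : ℕ} (F : E d → E d) (x : E d) : ℝ :=
  ∑ i : Fin d, (fderiv ℝ F x (EuclideanSpace.single i (1 : ℝ))) i

/-- The Gibbs density `exp (-V) / Z`, `Z = ∫_Θ exp (-V)`. -/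
def gibbs {d : ℕ} (Θ : Set (E d)) (V : E d → ℝ) (x : E d) : ℝ :=
  Real.exp (-V x) / ∫ y in Θ, Real.exp (-V y)

/-- The centered birth-death rate
`α = log ρ - log π - ∫_Θ (log ρ - log π) dρ` of a density `ρ`, with `π` the Gibbs density of `V`. -/
def rate {d : ℕ} (Θ : Set (E d)) (V ρ : E d → ℝ) (x : E d) : ℝ :=
  Real.log (ρ x) - Real.log (gibbs Θ V x)
    - ∫ y in Θ, (Real.log (ρ y) - Real.log (gibbs Θ V y)) * ρ y

/-- The time derivative `∂ₜ u (t, x)` on the time interval `[0, T]` (one-sided at the ends). -/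
def timeDeriv {d : ℕ} (T : ℝ) (u : ℝ → E d → ℝ) (t : ℝ) (x : E d) : ℝ :=
  derivWithin (fun s => u s x) (Icc 0 T) t

/-- The class `C^{1,2}` on `[0, T] × ℝ^d`: `u` is differentiable in time for every fixed point and
twice continuously differentiable in space for every fixed time, and `u` and `∂ₜ u` are continuous
on `[0, T] × ℝ^d`. (Joint continuity of the spatial derivatives is not required.) -/
structure IsC12 {d : ℕ} (T : ℝ) (u : ℝ → E d → ℝ) : Prop where
  continuousOn : ContinuousOn (fun p : ℝ × E d => u p.1 p.2) (Icc 0 T ×ˢ univ)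
  differentiableOn_time : ∀ x, DifferentiableOn ℝ (fun t => u t x) (Icc 0 T)
  continuousOn_timeDeriv :
    ContinuousOn (fun p : ℝ × E d => timeDeriv T u p.1 p.2) (Icc 0 T ×ˢ univ)
  contDiff_space : ∀ t ∈ Icc 0 T, ContDiff ℝ 2 (u t)

/-- `ρ` is a strictly positive classical solution on `[0, T] × Θ` of the transport-reaction equation
`∂ₜ ρ = ∇ · (∇ρ + ρ ∇V) - α ρ` whose initial value is a probability density. -/
structure IsPositiveSolution {d : ℕ} (Γ : Subgroup (E d ≃ᵢ E d)) (Θ : Set (E d))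
    (V : E d → ℝ) (T : ℝ) (ρ : ℝ → E d → ℝ) : Prop where
  isC12 : IsC12 T ρ
  isInvariant : ∀ t ∈ Icc 0 T, IsInvariant Γ (ρ t)
  pos : ∀ t ∈ Icc 0 T, ∀ x, 0 < ρ t x
  initial_mass : ∫ x in Θ, ρ 0 x = 1
  equation : ∀ t ∈ Icc 0 T, ∀ x,
    timeDeriv T ρ t x
      = divergence (fun y => gradient (ρ t) y + ρ t y • gradient V y) x
        - rate Θ V (ρ t) x * ρ t x

/-- The log-Sobolev inequality with constant `lam` for the probability density `p` on `Θ`: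
`∫ f² log f² dp ≤ (2 / lam) ∫ ‖∇f‖² dp` for all smooth `f` with `∫ f² dp = 1`. -/
def LogSobolev {d : ℕ} (Γ : Subgroup (E d ≃ᵢ E d)) (Θ : Set (E d))
    (p : E d → ℝ) (lam : ℝ) : Prop :=
  ∀ f : E d → ℝ, ContDiff ℝ (⊤ : ℕ∞) f → IsInvariant Γ f →
    ∫ x in Θ, f x ^ 2 * p x = 1 →
    ∫ x in Θ, f x ^ 2 * Real.log (f x ^ 2) * p x
      ≤ 2 / lam * ∫ x in Θ, ‖gradient f x‖ ^ 2 * p x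

/-- `KL(p ‖ q) = ∫_Θ log (p / q) dp` for densities `p`, `q` on `Θ`. -/
def kl {d : ℕ} (Θ : Set (E d)) (p q : E d → ℝ) : ℝ :=
  ∫ x in Θ, Real.log (p x / q x) * p x

/-- `max f - min f`. (The functions of interest are `Γ`-invariant, so that the extrema over `ℝ^d`
are the extrema over the compact quotient.) -/
def osc {d : ℕ} (f : E d → ℝ) : ℝ := (⨆ x, f x) - ⨅ x, f x

/-- The forcing term
`b_c(t) = Δ² / (4c) + (R₀')² / 16 e^{-2t} + S R₀ e^{-t} / 2 + 2 R₀' e^{-t}`. -/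
def forcing (Δgrad S R₀ R₀' c t : ℝ) : ℝ :=
  1 / (4 * c) * Δgrad ^ 2 + R₀' ^ 2 / 16 * Real.exp (-2 * t)
    + 1 / 2 * S * R₀ * Real.exp (-t) + 2 * R₀' * Real.exp (-t)

end SHK

end

/-!
Relative entropy between two transport-reaction flows with nearby potentials.

Write `w = log (ρ / π)`, `w' = log (ρ' / π')` for the log-densities, `g = log (ρ / ρ')`, and let
`I = ∫ ‖∇g‖² ρ` be the Fisher information of `ρ` relative to `ρ'`. The flux of the transport part
is `ρ ∇w`, so after an integration by parts the derivative of `H = KL (ρ ‖ ρ')` is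

`H' = -∫ ⟪∇g, ∇(w - w')⟫ ρ - ∫ g α ρ + ∫ α' ρ`        (`kl_deriv_eq`).

* As `∇(w - w') = ∇g + ∇V - ∇V'`, Young's inequality bounds the first term by
  `-(1 - c) I + Δ² / (4 c)` (`transport_le`).
* The second term is `-Cov_ρ (w, w - w' + log (π / π'))`. The variance of `w` absorbs the covariance
  with `w'` up to `Var (w') / 4`, and Popoviciu's inequality bounds variances by oscillations; the
  third term is at most the oscillation of `w'` (`birthDeath_le`).
* The maximum principle shows that the oscillations of `w` and `w'` decay like `e ^ (-t)`
  (`IsPositiveSolution.logDensity_sub_le`): at a spatial maximum of `w` transport only decreases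
  `w`, and the reaction contributes `-w` up to a function of time alone.
* Because `ρ' = e ^ w' π'`, the log-Sobolev inequality of `π'` passes to `ρ'` with constant
  `λ e ^ (-osc w')` by the Holley–Stroock perturbation argument (`LogSobolev.relativeEntropy_le`),
  which gives `2 λ e ^ (-osc w') H ≤ I` (`kl_le_fisher`).

Together these give the differential inequality, and Grönwall's inequality with `H 0 = 0` gives the
integrated bounds.

Integration by parts on `ℝ^d / Γ` uses no structure theory of `Γ`. It rests on the mass
transport principle (`IsClosedFlatDomain.mass_transport`): for a kernel `k` invariant under the
diagonal action, `∫_Θ ∫ k (x, y) dy dx = ∫_Θ ∫ k (x, y) dx dy`, since `Θ × ℝ^d` and `ℝ^d × Θ` are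
fundamental domains of the same action. Applied to kernels built from a radial mollifier, this is
the divergence theorem. Convolution with the same mollifiers extends the log-Sobolev inequality from
smooth functions to the `C^1` function `√(ρ / ρ')`.
-/

noncomputable section

namespace SHK

open Filter Topology
open scoped RealInnerProductSpace Convolution

variable {d : ℕ} {Γ : Subgroup (E d ≃ᵢ E d)} {Θ : Set (E d)} {T : ℝ}

/-! ### Euclidean isometries and invariant functions -/

/-- The linear part of a Euclidean isometry (which is affine by the Mazur–Ulam theorem). -/
def linearPart (γ : E d ≃ᵢ E d) : E d ≃ₗᵢ[ℝ] E d :=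
  γ.toRealAffineIsometryEquiv.linearIsometryEquiv

lemma isometry_sub_isometry (γ : E d ≃ᵢ E d) (x y : E d) :
    γ x - γ y = linearPart γ (x - y) := by
  have h := γ.toRealAffineIsometryEquiv.map_vsub x y
  simpa [linearPart] using h.symm

lemma isometry_sub (γ : E d ≃ᵢ E d) (x v : E d) : γ (x - v) = γ x - linearPart γ v := by
  have h := isometry_sub_isometry γ x (x - v)
  rw [sub_sub_cancel] at h
  rw [← h, sub_sub_cancel]

lemma isometry_eq_add (γ : E d ≃ᵢ E d) (x : E d) : γ x = linearPart γ x + γ 0 := by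
  have h := isometry_sub_isometry γ x 0
  rw [sub_zero] at h
  rw [← h, sub_add_cancel]

lemma hasFDerivAt_isometry (γ : E d ≃ᵢ E d) (x : E d) :
    HasFDerivAt γ ((linearPart γ).toContinuousLinearEquiv : E d →L[ℝ] E d) x := by
  have h : HasFDerivAt (fun y => linearPart γ y + γ 0)
      ((linearPart γ).toContinuousLinearEquiv : E d →L[ℝ] E d) x :=
    ((linearPart γ).toContinuousLinearEquiv.hasFDerivAt).add_const _
  exact h.congr_of_eventuallyEq (Eventually.of_forall fun y => isometry_eq_add γ y)

lemma measurePreserving_isometry (γ : E d ≃ᵢ E d) :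
    MeasurePreserving γ volume volume := by
  have h := (measurePreserving_add_right (volume : Measure (E d)) (γ 0)).comp
    (linearPart γ).measurePreserving
  have he : (fun x => x + γ 0) ∘ linearPart γ = γ := funext fun x => (isometry_eq_add γ x).symm
  rwa [he] at h

/-- A vector field on `ℝ^d` that descends to `ℝ^d / Γ`. -/
def IsEquivariant (Γ : Subgroup (E d ≃ᵢ E d)) (F : E d → E d) : Prop :=
  ∀ γ ∈ Γ, ∀ x, F (γ x) = linearPart γ (F x)

lemma IsInvariant.gradient {f : E d → ℝ} (hf : IsInvariant Γ f) (hd : Differentiable ℝ f) :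
    IsEquivariant Γ (gradient f) := by
  intro γ hγ x
  refine ext_inner_right ℝ fun v => ?_
  obtain ⟨u, rfl⟩ := (linearPart γ).surjective v
  rw [(linearPart γ).inner_map_map, inner_gradient_left, inner_gradient_left]
  have h := (hd (γ x)).hasFDerivAt.comp x (hasFDerivAt_isometry γ x)
  have he : f ∘ γ = f := funext fun y => hf γ hγ y
  rw [he] at h
  rw [h.fderiv]
  rfl

lemma IsEquivariant.smul {f : E d → ℝ} {F : E d → E d} (hf : IsInvariant Γ f)
    (hF : IsEquivariant Γ F) : IsEquivariant Γ fun x => f x • F x := by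
  intro γ hγ x
  simp only [hf γ hγ, hF γ hγ, map_smul]

lemma IsEquivariant.add {F G : E d → E d} (hF : IsEquivariant Γ F)
    (hG : IsEquivariant Γ G) : IsEquivariant Γ fun x => F x + G x := by
  intro γ hγ x
  simp only [hF γ hγ, hG γ hγ, map_add]

lemma IsEquivariant.norm {F : E d → E d} (hF : IsEquivariant Γ F) :
    IsInvariant Γ fun x => ‖F x‖ := by
  intro γ hγ x
  simp only [hF γ hγ, LinearIsometryEquiv.norm_map]

lemma divergence_eq_trace (F : E d → E d) (x : E d) :
    divergence F x = LinearMap.trace ℝ (E d) (fderiv ℝ F x : E d →ₗ[ℝ] E d) := by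
  rw [LinearMap.trace_eq_sum_inner _ (EuclideanSpace.basisFun (Fin d) ℝ)]
  simp [divergence, EuclideanSpace.inner_single_left]

lemma IsEquivariant.divergence {F : E d → E d} (hF : IsEquivariant Γ F)
    (hd : Differentiable ℝ F) : IsInvariant Γ (divergence F) := by
  intro γ hγ x
  set L := (linearPart γ).toContinuousLinearEquiv
  have h1 := (hd (γ x)).hasFDerivAt.comp x (hasFDerivAt_isometry γ x)
  have h2 : HasFDerivAt (F ∘ γ) ((L : E d →L[ℝ] E d).comp (fderiv ℝ F x)) x := by
    have he : F ∘ γ = fun y => L (F y) := funext fun y => hF γ hγ y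
    rw [he]
    exact L.hasFDerivAt.comp x (hd x).hasFDerivAt
  have h3 := h1.unique h2
  rw [divergence_eq_trace, divergence_eq_trace]
  have h4 : (fderiv ℝ F (γ x) : E d →ₗ[ℝ] E d)
      = L.toLinearEquiv.conj (fderiv ℝ F x : E d →ₗ[ℝ] E d) := by
    ext1 v
    obtain ⟨u, rfl⟩ := L.surjective v
    have := DFunLike.congr_fun h3 u
    simp only [ContinuousLinearMap.comp_apply] at this
    rw [LinearEquiv.conj_apply_apply]
    have hs : L.toLinearEquiv.symm (L u) = u := L.symm_apply_apply u
    rw [hs]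
    exact this
  rw [h4, LinearMap.trace_conj']

lemma continuous_divergence {F : E d → E d} (hF : ContDiff ℝ 1 F) :
    Continuous (divergence F) := by
  have h := hF.continuous_fderiv one_ne_zero
  unfold divergence
  fun_prop

lemma contDiff_gradient {f : E d → ℝ} {m n : WithTop ℕ∞} (hf : ContDiff ℝ n f)
    (hmn : m + 1 ≤ n) : ContDiff ℝ m (gradient f) :=
  (InnerProductSpace.toDual ℝ (E d)).symm.contDiff.comp (hf.fderiv_right hmn)

namespace IsClosedFlatDomain

variable (hΘ : IsClosedFlatDomain Γ Θ)
include hΘ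

lemma nonempty : Θ.Nonempty := by
  obtain ⟨γ, hγ, -⟩ := hΘ.existsUnique 0
  exact ⟨_, hγ⟩

lemma isCompact_closure : IsCompact (closure Θ) := hΘ.isBounded.isCompact_closure

lemma exists_mem (x : E d) : ∃ γ ∈ Γ, γ x ∈ Θ := by
  obtain ⟨γ, hγ, -⟩ := hΘ.existsUnique x
  exact ⟨γ, γ.2, hγ⟩

/-- A continuous function on the compact quotient attains its maximum. -/
lemma exists_forall_le {f : E d → ℝ} (hc : Continuous f) (hf : IsInvariant Γ f) :
    ∃ x₀, ∀ x, f x ≤ f x₀ := by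
  obtain ⟨x₀, -, h⟩ := hΘ.isCompact_closure.exists_isMaxOn hΘ.nonempty.closure hc.continuousOn
  refine ⟨x₀, fun x => ?_⟩
  obtain ⟨γ, hγ, hx⟩ := hΘ.exists_mem x
  rw [← hf γ hγ x]
  exact h (subset_closure hx)

lemma exists_norm_le {f : E d → ℝ} (hc : Continuous f) (hf : IsInvariant Γ f) :
    ∃ C, ∀ x, |f x| ≤ C := by
  obtain ⟨x₀, h⟩ := hΘ.exists_forall_le hc.abs (fun γ hγ x => by simp only [hf γ hγ])
  exact ⟨_, h⟩

lemma bddAbove_range {f : E d → ℝ} (hc : Continuous f) (hf : IsInvariant Γ f) :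
    BddAbove (range f) := by
  obtain ⟨x₀, h⟩ := hΘ.exists_forall_le hc hf
  exact ⟨_, forall_mem_range.2 h⟩

lemma bddBelow_range {f : E d → ℝ} (hc : Continuous f) (hf : IsInvariant Γ f) :
    BddBelow (range f) := by
  obtain ⟨C, h⟩ := hΘ.exists_norm_le hc hf
  exact ⟨-C, forall_mem_range.2 fun x => (abs_le.1 (h x)).1⟩

lemma sub_le_osc {f : E d → ℝ} (hc : Continuous f) (hf : IsInvariant Γ f) (x y : E d) :
    f x - f y ≤ osc f :=
  sub_le_sub (le_ciSup (hΘ.bddAbove_range hc hf) x) (ciInf_le (hΘ.bddBelow_range hc hf) y)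

lemma integrableOn {F : Type*} [NormedAddCommGroup F] {f : E d → F} (hc : Continuous f) :
    IntegrableOn f Θ :=
  (hc.continuousOn.integrableOn_compact hΘ.isCompact_closure).mono_set subset_closure

lemma measure_lt_top : volume Θ < ⊤ := hΘ.isBounded.measure_lt_top

end IsClosedFlatDomain

/-! ### The mass transport principle -/

/-- The tautological action of the group of isometries on the space. -/
instance isometryMulAction : MulAction (E d ≃ᵢ E d) (E d) where
  smul γ x := γ x
  one_smul _ := rfl
  mul_smul _ _ _ := rfl

lemma subgroup_smul_def (γ : Γ) (x : E d) : γ • x = (γ : E d ≃ᵢ E d) x := rfl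

lemma measurePreserving_diagonal (γ : Γ) :
    MeasurePreserving (fun p : E d × E d => γ • p) (volume.prod volume) (volume.prod volume) :=
  (measurePreserving_isometry (γ : E d ≃ᵢ E d)).prod (measurePreserving_isometry _)

namespace IsClosedFlatDomain

variable (hΘ : IsClosedFlatDomain Γ Θ)
include hΘ

lemma volume_pos : 0 < volume Θ := by
  have := hΘ.countable
  have : MeasurableConstSMul Γ (E d) := ⟨fun γ => (γ : E d ≃ᵢ E d).continuous.measurable⟩
  have : SMulInvariantMeasure Γ (E d) volume := ⟨fun γ s hs =>
    (measurePreserving_isometry (γ : E d ≃ᵢ E d)).measure_preimage hs.nullMeasurableSet⟩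
  have h : IsFundamentalDomain Γ Θ (volume : Measure (E d)) :=
    .mk' hΘ.measurableSet.nullMeasurableSet hΘ.existsUnique
  exact pos_iff_ne_zero.2 (h.measure_ne_zero (NeZero.ne _))

/-- **Mass transport principle**: both `Θ × ℝ^d` and `ℝ^d × Θ` are fundamental domains of the
diagonal action of `Γ` on `ℝ^d × ℝ^d`. -/
lemma mass_transport {k : E d → E d → ℝ}
    (hk : ∀ γ ∈ Γ, ∀ x y, k (γ x) (γ y) = k x y) (hc : Continuous fun p : E d × E d => k p.1 p.2)
    {r : ℝ} (hr : ∀ x y, r < dist x y → k x y = 0) :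
    ∫ x in Θ, ∫ y, k x y = ∫ y in Θ, ∫ x, k x y := by
  have := hΘ.countable
  have : MeasurableConstSMul Γ (E d × E d) := ⟨fun γ => (measurePreserving_diagonal γ).measurable⟩
  have : SMulInvariantMeasure Γ (E d × E d) (volume.prod volume) := ⟨fun γ s hs =>
    (measurePreserving_diagonal γ).measure_preimage hs.nullMeasurableSet⟩
  have h1 : IsFundamentalDomain Γ (Θ ×ˢ univ : Set (E d × E d)) (volume.prod volume) :=
    .mk' (hΘ.measurableSet.prod .univ).nullMeasurableSet fun p => by
      simpa [subgroup_smul_def] using hΘ.existsUnique p.1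
  have h2 : IsFundamentalDomain Γ (univ ×ˢ Θ : Set (E d × E d)) (volume.prod volume) :=
    .mk' (MeasurableSet.univ.prod hΘ.measurableSet).nullMeasurableSet fun p => by
      simpa [subgroup_smul_def] using hΘ.existsUnique p.2
  have hkey := h1.setIntegral_eq h2 (f := fun p => k p.1 p.2) (fun γ p => hk γ γ.2 p.1 p.2)
  -- outside a compact set the kernel vanishes on both domains
  obtain ⟨R, hR⟩ := hΘ.isBounded.subset_closedBall (0 : E d)
  have hcomp : IsCompact (Metric.closedBall (0 : E d) (R + r) ×ˢ Metric.closedBall (0 : E d) R) :=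
    (isCompact_closedBall _ _).prod (isCompact_closedBall _ _)
  have hcomp' : IsCompact (Metric.closedBall (0 : E d) R ×ˢ Metric.closedBall (0 : E d) (R + r)) :=
    (isCompact_closedBall _ _).prod (isCompact_closedBall _ _)
  have i1 : IntegrableOn (fun p : E d × E d => k p.1 p.2) (Θ ×ˢ univ) (volume.prod volume) := by
    refine (hc.continuousOn.integrableOn_compact hcomp').of_forall_sdiff_eq_zero
      (hΘ.measurableSet.prod .univ) ?_
    rintro ⟨x, y⟩ ⟨⟨hx, -⟩, hn⟩
    refine hr x y ?_
    by_contra! hle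
    refine hn ⟨hR hx, ?_⟩
    have hx' := hR hx
    rw [Metric.mem_closedBall] at hx' ⊢
    linarith [dist_triangle y x 0, dist_comm x y]
  have i2 : IntegrableOn (fun p : E d × E d => k p.1 p.2) (univ ×ˢ Θ) (volume.prod volume) := by
    refine (hc.continuousOn.integrableOn_compact hcomp).of_forall_sdiff_eq_zero
      (MeasurableSet.univ.prod hΘ.measurableSet) ?_
    rintro ⟨x, y⟩ ⟨⟨-, hy⟩, hn⟩
    refine hr x y ?_
    by_contra! hle
    refine hn ⟨?_, hR hy⟩
    have hy' := hR hy
    rw [Metric.mem_closedBall] at hy' ⊢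
    linarith [dist_triangle x y 0]
  have h3 := setIntegral_prod (fun z : E d × E d => k z.2 z.1) i2.swap
  have h4 := setIntegral_prod_swap (μ := (volume : Measure (E d))) (ν := (volume : Measure (E d)))
    univ Θ (fun z : E d × E d => k z.1 z.2)
  simp only [Prod.fst_swap, Prod.snd_swap] at h4
  rw [setIntegral_prod _ i1, ← h4, h3] at hkey
  simpa using hkey

end IsClosedFlatDomain

/-! ### Radial mollifiers -/

/-- A radially symmetric smooth bump function of integral one, supported in the ball of radius
`r`. Radial symmetry makes the convolution with it commute with all isometries. -/
def mollifier (d : ℕ) (r : ℝ) (x : E d) : ℝ :=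
  expNegInvGlue (r ^ 2 - ‖x‖ ^ 2) / ∫ y : E d, expNegInvGlue (r ^ 2 - ‖y‖ ^ 2)

section Mollifier

variable {r : ℝ}

lemma contDiff_bump (r : ℝ) (n : ℕ∞) :
    ContDiff ℝ n fun x : E d => expNegInvGlue (r ^ 2 - ‖x‖ ^ 2) :=
  expNegInvGlue.contDiff.comp (contDiff_const.sub (contDiff_norm_sq ℝ))

lemma bump_eq_zero (hr : 0 < r) {x : E d} (hx : r ≤ ‖x‖) :
    expNegInvGlue (r ^ 2 - ‖x‖ ^ 2) = 0 :=
  expNegInvGlue.zero_of_nonpos (by nlinarith)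

lemma hasCompactSupport_bump (hr : 0 < r) :
    HasCompactSupport fun x : E d => expNegInvGlue (r ^ 2 - ‖x‖ ^ 2) :=
  HasCompactSupport.intro (isCompact_closedBall (0 : E d) r) fun x hx =>
    bump_eq_zero hr (by
      simp only [Metric.mem_closedBall, dist_zero_right, not_le] at hx; exact hx.le)

lemma integral_bump_pos (hr : 0 < r) : 0 < ∫ y : E d, expNegInvGlue (r ^ 2 - ‖y‖ ^ 2) := by
  have hc : Continuous fun x : E d => expNegInvGlue (r ^ 2 - ‖x‖ ^ 2) :=
    (contDiff_bump r 0).continuous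
  refine hc.integral_pos_of_hasCompactSupport_nonneg_nonzero (hasCompactSupport_bump hr)
    (fun x => expNegInvGlue.nonneg _) (x := 0) ?_
  have : 0 < expNegInvGlue (r ^ 2 - ‖(0 : E d)‖ ^ 2) :=
    expNegInvGlue.pos_of_pos (by simpa using by positivity)
  exact this.ne'

lemma contDiff_mollifier (r : ℝ) (n : ℕ∞) : ContDiff ℝ n (mollifier d r) :=
  (contDiff_bump r n).div_const _

lemma continuous_mollifier (r : ℝ) : Continuous (mollifier d r) :=
  (contDiff_mollifier r 0).continuous

lemma mollifier_nonneg (hr : 0 < r) (x : E d) : 0 ≤ mollifier d r x :=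
  div_nonneg (expNegInvGlue.nonneg _) (integral_bump_pos hr).le

lemma mollifier_eq_zero (hr : 0 < r) {x : E d} (hx : r ≤ ‖x‖) : mollifier d r x = 0 := by
  rw [mollifier, bump_eq_zero hr hx, zero_div]

lemma hasCompactSupport_mollifier (hr : 0 < r) : HasCompactSupport (mollifier d r) :=
  HasCompactSupport.intro (isCompact_closedBall (0 : E d) r) fun x hx =>
    mollifier_eq_zero hr (by
      simp only [Metric.mem_closedBall, dist_zero_right, not_le] at hx; exact hx.le)

lemma integrable_mollifier (hr : 0 < r) : Integrable (mollifier d r) :=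
  (continuous_mollifier r).integrable_of_hasCompactSupport (hasCompactSupport_mollifier hr)

lemma integral_mollifier (hr : 0 < r) : ∫ x, mollifier d r x = 1 := by
  simp only [mollifier]
  rw [integral_div, div_self (integral_bump_pos hr).ne']

lemma mollifier_map (L : E d ≃ₗᵢ[ℝ] E d) (r : ℝ) (x : E d) :
    mollifier d r (L x) = mollifier d r x := by
  simp only [mollifier, L.norm_map]

lemma fderiv_mollifier_map (L : E d ≃ₗᵢ[ℝ] E d) (r : ℝ) (x v : E d) :
    fderiv ℝ (mollifier d r) (L x) (L v) = fderiv ℝ (mollifier d r) x v := by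
  have hd : Differentiable ℝ (mollifier d r) := (contDiff_mollifier r 1).differentiable one_ne_zero
  have h := (hd (L x)).hasFDerivAt.comp x L.toContinuousLinearEquiv.hasFDerivAt
  have he : mollifier d r ∘ L = mollifier d r :=
    funext fun y => mollifier_map L r y
  rw [he] at h
  rw [h.fderiv]
  rfl

lemma fderiv_mollifier_eq_zero (hr : 0 < r) {x : E d} (hx : r < ‖x‖) :
    fderiv ℝ (mollifier d r) x = 0 := by
  have : mollifier d r =ᶠ[𝓝 x] fun _ => 0 := by
    filter_upwards [continuous_norm.continuousAt.eventually_const_lt hx] with y hy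
    exact mollifier_eq_zero hr hy.le
  rw [this.fderiv_eq]
  simp

lemma integral_fderiv_mollifier (hr : 0 < r) (v : E d) :
    ∫ x, fderiv ℝ (mollifier d r) x v = 0 := by
  have hd : Differentiable ℝ (mollifier d r) := (contDiff_mollifier r 1).differentiable one_ne_zero
  have hc : Continuous fun x => fderiv ℝ (mollifier d r) x v :=
    ((contDiff_mollifier r 1).continuous_fderiv one_ne_zero).clm_apply continuous_const
  have hi : Integrable fun x => fderiv ℝ (mollifier d r) x v :=
    hc.integrable_of_hasCompactSupport
      (((hasCompactSupport_mollifier hr).fderiv (𝕜 := ℝ)).comp_left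
        (g := fun L : E d →L[ℝ] ℝ => L v) rfl)
  have h := integral_mul_fderiv_eq_neg_fderiv_mul_of_integrable (μ := (volume : Measure (E d)))
    (f := fun _ => (1 : ℝ)) (g := mollifier d r) (v := v) (by simp) (by simpa using hi)
    (by simpa using integrable_mollifier hr) (fun _ _ => differentiableAt_const _) (fun x _ => hd x)
  simpa using h

end Mollifier

/-! ### The divergence theorem on the quotient -/

/-- Integration by parts on the whole space against a compactly supported test function. -/
lemma integral_mul_divergence {φ : E d → ℝ} (hφ : ContDiff ℝ 1 φ) (hφc : HasCompactSupport φ)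
    {F : E d → E d} (hF : ContDiff ℝ 1 F) :
    ∫ y, φ y * divergence F y = -∫ y, fderiv ℝ φ y (F y) := by
  have hcφ : Continuous φ := hφ.continuous
  have hcφ' := hφ.continuous_fderiv one_ne_zero
  have hFi : ∀ i, ContDiff ℝ 1 fun y => F y i := fun i => by fun_prop
  have hcF : ∀ i, Continuous fun y => F y i := fun i => (hFi i).continuous
  have hcF' := fun i => (hFi i).continuous_fderiv one_ne_zero
  have hsupp : ∀ v, HasCompactSupport fun y => fderiv ℝ φ y v := fun v =>
    (hφc.fderiv (𝕜 := ℝ)).comp_left (g := fun L : E d →L[ℝ] ℝ => L v) rfl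
  have hpart : ∀ i, ∫ y, φ y * fderiv ℝ (fun y => F y i) y (EuclideanSpace.single i 1)
      = -∫ y, fderiv ℝ φ y (EuclideanSpace.single i 1) * F y i := fun i =>
    integral_mul_fderiv_eq_neg_fderiv_mul_of_integrable
      (((hcφ'.clm_apply continuous_const).mul (hcF i)).integrable_of_hasCompactSupport
        (hsupp _).mul_right)
      ((hcφ.mul ((hcF' i).clm_apply continuous_const)).integrable_of_hasCompactSupport
        hφc.mul_right)
      ((hcφ.mul (hcF i)).integrable_of_hasCompactSupport hφc.mul_right)
      (fun x _ => hφ.differentiable one_ne_zero x) (fun x _ => (hFi i).differentiable one_ne_zero x)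
  have hdiv : ∀ y, φ y * divergence F y
      = ∑ i, φ y * fderiv ℝ (fun y => F y i) y (EuclideanSpace.single i 1) := fun y => by
    rw [divergence, Finset.mul_sum]
    refine Finset.sum_congr rfl fun i _ => ?_
    have h : HasFDerivAt (fun y => F y i)
        ((EuclideanSpace.proj i : E d →L[ℝ] ℝ).comp (fderiv ℝ F y)) y :=
      (EuclideanSpace.proj i : E d →L[ℝ] ℝ).hasFDerivAt.comp y
        (hF.differentiable one_ne_zero y).hasFDerivAt
    rw [h.fderiv]
    rfl
  have hgrad : ∀ y, fderiv ℝ φ y (F y)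
      = ∑ i, fderiv ℝ φ y (EuclideanSpace.single i 1) * F y i := fun y => by
    conv_lhs => rw [← (EuclideanSpace.basisFun (Fin d) ℝ).sum_repr (F y)]
    simp [mul_comm]
  simp only [hdiv, hgrad]
  rw [integral_finsetSum, integral_finsetSum, ← Finset.sum_neg_distrib]
  · exact Finset.sum_congr rfl fun i _ => hpart i
  · exact fun i _ => ((hcφ'.clm_apply continuous_const).mul (hcF i)).integrable_of_hasCompactSupport
        (hsupp _).mul_right
  · exact fun i _ =>
      (hcφ.mul ((hcF' i).clm_apply continuous_const)).integrable_of_hasCompactSupport hφc.mul_right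

namespace IsClosedFlatDomain

variable (hΘ : IsClosedFlatDomain Γ Θ)
include hΘ

/-- **Divergence theorem** on the closed manifold `ℝ^d / Γ`. Mass transport replaces `∇ · F` by its
mollification; after an integration by parts on `ℝ^d` the derivative falls on the mollifier, and a
second mass transport leaves the integral of the gradient of a bump function. -/
theorem setIntegral_divergence {F : E d → E d} (hF : ContDiff ℝ 1 F) (hFΓ : IsEquivariant Γ F) :
    ∫ x in Θ, divergence F x = 0 := by
  have hr : (0 : ℝ) < 1 := one_pos
  set η := mollifier d 1
  have hη : ContDiff ℝ 1 η := contDiff_mollifier 1 1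
  have hmap : ∀ (L : E d ≃ₗᵢ[ℝ] E d) x, η (L x) = η x := fun L => mollifier_map L 1
  have hmap' : ∀ (L : E d ≃ₗᵢ[ℝ] E d) x v, fderiv ℝ η (L x) (L v) = fderiv ℝ η x v := fun L =>
    fderiv_mollifier_map L 1
  have hcη : Continuous η := hη.continuous
  have hcη' := hη.continuous_fderiv one_ne_zero
  have hcF := hF.continuous
  have hcdiv := continuous_divergence hF
  have hinv := hFΓ.divergence (hF.differentiable one_ne_zero)
  have h1 := hΘ.mass_transport (k := fun x y => η (x - y) * divergence F y) (r := 1)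
    (fun γ hγ x y => by rw [isometry_sub_isometry, hmap, hinv γ hγ]) (by fun_prop)
    (fun x y hxy => mul_eq_zero_of_left
      (mollifier_eq_zero hr (by rw [← dist_eq_norm]; exact hxy.le)) _)
  have h2 := hΘ.mass_transport (k := fun x y => fderiv ℝ η (x - y) (F y)) (r := 1)
    (fun γ hγ x y => by rw [isometry_sub_isometry, hFΓ γ hγ, hmap'])
    (by fun_prop)
    (fun x y hxy => by
      rw [fderiv_mollifier_eq_zero hr (by rw [← dist_eq_norm]; exact hxy)]; rfl)
  have h3 : ∀ x, ∫ y, η (x - y) * divergence F y = ∫ y, fderiv ℝ η (x - y) (F y) := fun x => by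
    have hc : HasCompactSupport fun y => η (x - y) :=
      (hasCompactSupport_mollifier hr).comp_homeomorph (Homeomorph.subLeft x)
    rw [integral_mul_divergence (φ := fun y => η (x - y)) (by fun_prop) hc hF, ← integral_neg]
    refine integral_congr_ae (Eventually.of_forall fun y => ?_)
    have h : HasFDerivAt (fun y => η (x - y))
        ((fderiv ℝ η (x - y)).comp (-ContinuousLinearMap.id ℝ (E d))) y :=
      (hη.differentiable one_ne_zero (x - y)).hasFDerivAt.comp y
        ((hasFDerivAt_id y).const_sub x)
    simp only [h.fderiv]
    simp
  have h4 : ∀ y, ∫ x, fderiv ℝ η (x - y) (F y) = 0 := fun y => by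
    rw [integral_sub_right_eq_self (fun z => fderiv ℝ η z (F y)), integral_fderiv_mollifier hr]
  have h5 : ∀ y, ∫ x, η (x - y) = 1 := fun y => by
    rw [integral_sub_right_eq_self η, integral_mollifier hr]
  simp only [h3, h2, h4, integral_mul_const, h5] at h1
  simpa using h1.symm

/-- Green's formula: integration by parts on the closed manifold `ℝ^d / Γ`. -/
theorem setIntegral_mul_divergence {φ : E d → ℝ} (hφ : ContDiff ℝ 1 φ) (hφΓ : IsInvariant Γ φ)
    {F : E d → E d} (hF : ContDiff ℝ 1 F) (hFΓ : IsEquivariant Γ F) :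
    ∫ x in Θ, φ x * divergence F x = -∫ x in Θ, ⟪gradient φ x, F x⟫ := by
  have h := hΘ.setIntegral_divergence (F := fun x => φ x • F x) (by fun_prop) (hFΓ.smul hφΓ)
  have he : ∀ x, divergence (fun x => φ x • F x) x
      = φ x * divergence F x + ⟪gradient φ x, F x⟫ := fun x => by
    have h1 : HasFDerivAt (fun x => φ x • F x)
        (φ x • fderiv ℝ F x + (fderiv ℝ φ x).smulRight (F x)) x :=
      (hφ.differentiable one_ne_zero x).hasFDerivAt.smul
        (hF.differentiable one_ne_zero x).hasFDerivAt
    rw [inner_gradient_left, divergence, h1.fderiv, divergence]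
    conv_rhs => rw [← (EuclideanSpace.basisFun (Fin d) ℝ).sum_repr (F x)]
    simp [Finset.mul_sum, Finset.sum_add_distrib, mul_comm]
  have hcF := hF.continuous
  have hcφ := hφ.continuous
  have hcd := continuous_divergence hF
  have hcg : Continuous (gradient φ) := (contDiff_gradient (m := 0) hφ (by norm_num)).continuous
  simp only [he] at h
  rw [integral_add (hΘ.integrableOn (by fun_prop)) (hΘ.integrableOn (by fun_prop))] at h
  linarith

end IsClosedFlatDomain

/-! ### Log-Sobolev inequalities for `C^1` functions and perturbed densities -/

lemma norm_mollifier_convolution_le {F : Type*} [NormedAddCommGroup F] [NormedSpace ℝ F]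
    {r : ℝ} (hr : 0 < r) {h : E d → F} {C : ℝ} (hC : ∀ x, ‖h x‖ ≤ C) (x : E d) :
    ‖(mollifier d r ⋆[ContinuousLinearMap.lsmul ℝ ℝ, volume] h) x‖ ≤ C := by
  have hb : ∀ t, ‖mollifier d r t • h (x - t)‖ ≤ mollifier d r t * C := fun t => by
    rw [norm_smul, Real.norm_of_nonneg (mollifier_nonneg hr t)]
    exact mul_le_mul_of_nonneg_left (hC _) (mollifier_nonneg hr t)
  have := norm_integral_le_of_norm_le ((integrable_mollifier hr).mul_const C)
    (Eventually.of_forall hb)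
  rwa [integral_mul_const, integral_mollifier hr, one_mul] at this

lemma tendsto_mollifier_convolution {F : Type*} [NormedAddCommGroup F] [NormedSpace ℝ F]
    [CompleteSpace F] {h : E d → F} (hc : Continuous h) (x : E d) :
    Tendsto (fun n : ℕ =>
      (mollifier d (1 / (n + 1 : ℝ)) ⋆[ContinuousLinearMap.lsmul ℝ ℝ, volume] h) x)
      atTop (𝓝 (h x)) := by
  refine convolution_tendsto_right (g := fun _ => h) (k := fun _ => x) (x₀ := x)
    (Eventually.of_forall fun n => mollifier_nonneg (by positivity))
    (Eventually.of_forall fun n => integral_mollifier (by positivity)) ?_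
    (Eventually.of_forall fun n => hc.aestronglyMeasurable) ?_ tendsto_const_nhds
  · rw [tendsto_smallSets_iff]
    intro U hU
    obtain ⟨ε, hε, hU⟩ := Metric.mem_nhds_iff.1 hU
    filter_upwards [(tendsto_one_div_add_atTop_nhds_zero_nat (𝕜 := ℝ)).eventually_lt_const hε]
      with n hn y hy
    refine hU ?_
    rw [mem_ball_zero_iff]
    by_contra! hle
    exact hy (mollifier_eq_zero (by positivity) (hn.le.trans hle))
  · exact (hc.tendsto x).comp tendsto_snd

lemma IsInvariant.mollifier_convolution {f : E d → ℝ} (hf : IsInvariant Γ f) (r : ℝ) :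
    IsInvariant Γ (mollifier d r ⋆[ContinuousLinearMap.lsmul ℝ ℝ, volume] f) := by
  intro γ hγ x
  simp only [convolution_def, ContinuousLinearMap.lsmul_apply]
  rw [← (linearPart γ).measurePreserving.integral_comp
    (linearPart γ).toHomeomorph.measurableEmbedding]
  refine integral_congr_ae (Eventually.of_forall fun t => ?_)
  simp only [mollifier_map, ← isometry_sub, hf γ hγ]

lemma gradient_mollifier_convolution {r : ℝ} (hr : 0 < r) {f : E d → ℝ} (hf : ContDiff ℝ 1 f)
    {C : ℝ} (hC : ∀ x, ‖gradient f x‖ ≤ C) (x : E d) :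
    gradient (mollifier d r ⋆[ContinuousLinearMap.lsmul ℝ ℝ, volume] f) x
      = (mollifier d r ⋆[ContinuousLinearMap.lsmul ℝ ℝ, volume] gradient f) x := by
  have hcη := continuous_mollifier (d := d) r
  have hcf := hf.continuous
  have hcg : Continuous (gradient f) := (contDiff_gradient (m := 0) hf (by norm_num)).continuous
  have hsupp := hasCompactSupport_mollifier (d := d) hr
  have hint : ∀ y, Integrable fun t => mollifier d r t • gradient f (y - t) := fun y =>
    Continuous.integrable_of_hasCompactSupport (by fun_prop) hsupp.smul_right
  have h := hasFDerivAt_integral_of_dominated_of_fderiv_le (μ := (volume : Measure (E d)))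
    (F := fun x t => mollifier d r t • f (x - t))
    (F' := fun x t => InnerProductSpace.toDual ℝ (E d) (mollifier d r t • gradient f (x - t)))
    (x₀ := x) (s := univ) (bound := fun t => mollifier d r t * C) univ_mem
    (Eventually.of_forall fun y => Continuous.aestronglyMeasurable (by fun_prop))
    (Continuous.integrable_of_hasCompactSupport (by fun_prop) hsupp.smul_right)
    (Continuous.aestronglyMeasurable (by fun_prop))
    (Eventually.of_forall fun t y _ => by
      rw [LinearIsometryEquiv.norm_map, norm_smul, Real.norm_of_nonneg (mollifier_nonneg hr t)]
      exact mul_le_mul_of_nonneg_left (hC _) (mollifier_nonneg hr t))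
    ((integrable_mollifier hr).mul_const C)
    (Eventually.of_forall fun t y _ => by
      have h1 := (hf.differentiable one_ne_zero (y - t)).hasFDerivAt.comp y
        ((hasFDerivAt_id y).sub_const t)
      have h2 := h1.const_smul (mollifier d r t)
      rw [map_smul, toDual_gradient]
      exact h2)
  have h3 := ContinuousLinearMap.integral_comp_comm
    (InnerProductSpace.toDual ℝ (E d)).toContinuousLinearEquiv.toContinuousLinearMap (hint x)
  refine HasGradientAt.gradient (hasGradientAt_iff_hasFDerivAt.2 ?_)
  exact h3 ▸ h

namespace IsClosedFlatDomain

variable (hΘ : IsClosedFlatDomain Γ Θ)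
include hΘ

/-- A `C^1` function on the quotient is a limit of smooth functions on the quotient, pointwise and
boundedly together with the gradients. -/
lemma exists_smooth_approx {f : E d → ℝ} (hf : ContDiff ℝ 1 f) (hfΓ : IsInvariant Γ f) :
    ∃ (g : ℕ → E d → ℝ) (C : ℝ), (∀ n, ContDiff ℝ (⊤ : ℕ∞) (g n)) ∧ (∀ n, IsInvariant Γ (g n)) ∧
      (∀ n x, |g n x| ≤ C) ∧ (∀ n x, ‖gradient (g n) x‖ ≤ C) ∧
      (∀ x, Tendsto (fun n => g n x) atTop (𝓝 (f x))) ∧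
      ∀ x, Tendsto (fun n => gradient (g n) x) atTop (𝓝 (gradient f x)) := by
  have hcg : Continuous (gradient f) := (contDiff_gradient (m := 0) hf (by norm_num)).continuous
  obtain ⟨C₁, h1⟩ := hΘ.exists_norm_le hf.continuous hfΓ
  obtain ⟨C₂, h2⟩ := hΘ.exists_norm_le hcg.norm (hfΓ.gradient (hf.differentiable one_ne_zero)).norm
  simp only [abs_norm] at h2
  have hr : ∀ n : ℕ, (0 : ℝ) < 1 / (n + 1 : ℝ) := fun n => by positivity
  have hgr := fun n x => gradient_mollifier_convolution (hr n) hf h2 x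
  refine ⟨fun n => mollifier d (1 / (n + 1 : ℝ)) ⋆[ContinuousLinearMap.lsmul ℝ ℝ, volume] f,
    max C₁ C₂, fun n => ?_, fun n => hfΓ.mollifier_convolution _, fun n x => ?_, fun n x => ?_,
    fun x => tendsto_mollifier_convolution hf.continuous x, fun x => ?_⟩
  · exact (hasCompactSupport_mollifier (hr n)).contDiff_convolution_left _
      (contDiff_mollifier _ _) hf.continuous.locallyIntegrable
  · exact (norm_mollifier_convolution_le (hr n) (h := f) h1 x).trans (le_max_left _ _)
  · rw [hgr]
    exact (norm_mollifier_convolution_le (hr n) h2 x).trans (le_max_right _ _)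
  · simp only [hgr]
    exact tendsto_mollifier_convolution hcg x

lemma tendsto_setIntegral_mul {u : ℕ → E d → ℝ} {v p : E d → ℝ} {K : ℝ} (hp : Continuous p)
    (hu : ∀ n, Continuous (u n)) (hK : ∀ n x, |u n x| ≤ K)
    (h : ∀ x, Tendsto (fun n => u n x) atTop (𝓝 (v x))) :
    Tendsto (fun n => ∫ x in Θ, u n x * p x) atTop (𝓝 (∫ x in Θ, v x * p x)) := by
  refine tendsto_integral_of_dominated_convergence (fun x => K * |p x|)
    (fun n => ((hu n).mul hp).aestronglyMeasurable)
    (hΘ.integrableOn (by fun_prop)) (fun n => Eventually.of_forall fun x => ?_)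
    (Eventually.of_forall fun x => (h x).mul_const _)
  rw [Real.norm_eq_abs, abs_mul]
  exact mul_le_mul_of_nonneg_right (hK n x) (abs_nonneg _)

end IsClosedFlatDomain

lemma continuous_sq_mul_log_sq : Continuous fun s : ℝ => s ^ 2 * Real.log (s ^ 2) :=
  Real.continuous_mul_log.comp (continuous_pow 2)

/-- The log-Sobolev inequality in its homogeneous form, for smooth functions. -/
lemma LogSobolev.entropy_le_of_smooth (hΘ : IsClosedFlatDomain Γ Θ) {p : E d → ℝ} {lam : ℝ}
    (hLSI : LogSobolev Γ Θ p lam) (hp : Continuous p) {f : E d → ℝ}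
    (hf : ContDiff ℝ (⊤ : ℕ∞) f) (hfΓ : IsInvariant Γ f) (hN : 0 < ∫ x in Θ, f x ^ 2 * p x) :
    (∫ x in Θ, f x ^ 2 * Real.log (f x ^ 2) * p x)
        - Real.log (∫ x in Θ, f x ^ 2 * p x) * ∫ x in Θ, f x ^ 2 * p x
      ≤ 2 / lam * ∫ x in Θ, ‖gradient f x‖ ^ 2 * p x := by
  set N := ∫ x in Θ, f x ^ 2 * p x
  set s := (Real.sqrt N)⁻¹ with hs
  have hs2 : s ^ 2 = N⁻¹ := by rw [hs, inv_pow, Real.sq_sqrt hN.le]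
  have hcf := hf.continuous
  have h := hLSI (fun x => s * f x) (contDiff_const.mul hf) (fun γ hγ x => by simp only [hfΓ γ hγ])
    (by
      simp only [mul_pow, hs2, mul_assoc]
      rw [integral_const_mul]
      exact inv_mul_cancel₀ hN.ne')
  have h1 : ∀ x, (s * f x) ^ 2 * Real.log ((s * f x) ^ 2) * p x
      = N⁻¹ * (f x ^ 2 * Real.log (f x ^ 2) * p x - Real.log N * (f x ^ 2 * p x)) := fun x => by
    rcases eq_or_ne (f x) 0 with h0 | h0
    · simp [h0]
    · rw [mul_pow, hs2, Real.log_mul (inv_ne_zero hN.ne') (pow_ne_zero 2 h0), Real.log_inv]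
      ring
  have h2 : ∀ x, ‖gradient (fun x => s * f x) x‖ ^ 2 * p x = N⁻¹ * (‖gradient f x‖ ^ 2 * p x) :=
    fun x => by
    have hg : HasGradientAt (fun x => s * f x) (s • gradient f x) x := by
      rw [hasGradientAt_iff_hasFDerivAt, map_smul, toDual_gradient]
      exact (hf.differentiable (by simp) x).hasFDerivAt.const_mul s
    rw [hg.gradient, norm_smul, mul_pow, Real.norm_eq_abs, sq_abs, hs2, mul_assoc]
  have hi : IntegrableOn (fun x => f x ^ 2 * Real.log (f x ^ 2) * p x) Θ :=
    hΘ.integrableOn ((continuous_sq_mul_log_sq.comp hcf).mul hp)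
  have hi' : IntegrableOn (fun x => Real.log N * (f x ^ 2 * p x)) Θ :=
    hΘ.integrableOn (by fun_prop)
  simp only [h1, h2] at h
  rw [integral_const_mul, integral_const_mul, integral_sub hi hi', integral_const_mul,
    mul_left_comm] at h
  exact le_of_mul_le_mul_left h (inv_pos.2 hN)

/-- The homogeneous log-Sobolev inequality for `C^1` functions, by mollification. -/
lemma LogSobolev.entropy_le (hΘ : IsClosedFlatDomain Γ Θ) {p : E d → ℝ} {lam : ℝ}
    (hLSI : LogSobolev Γ Θ p lam) (hp : Continuous p) {f : E d → ℝ}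
    (hf : ContDiff ℝ 1 f) (hfΓ : IsInvariant Γ f) (hN : 0 < ∫ x in Θ, f x ^ 2 * p x) :
    (∫ x in Θ, f x ^ 2 * Real.log (f x ^ 2) * p x)
        - Real.log (∫ x in Θ, f x ^ 2 * p x) * ∫ x in Θ, f x ^ 2 * p x
      ≤ 2 / lam * ∫ x in Θ, ‖gradient f x‖ ^ 2 * p x := by
  obtain ⟨g, C, hg, hgΓ, hC, hC', hlim, hlim'⟩ := hΘ.exists_smooth_approx hf hfΓ
  have hcg : ∀ n, Continuous (g n) := fun n => (hg n).continuous
  have hcg' : ∀ n, Continuous (gradient (g n)) := fun n =>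
    (contDiff_gradient (m := 0) (hg n) (by norm_num)).continuous
  obtain ⟨K, hK⟩ := (isCompact_Icc (a := -C) (b := C)).exists_bound_of_continuousOn
    continuous_sq_mul_log_sq.continuousOn
  have l1 : Tendsto (fun n => ∫ x in Θ, g n x ^ 2 * p x) atTop (𝓝 (∫ x in Θ, f x ^ 2 * p x)) :=
    hΘ.tendsto_setIntegral_mul (K := C ^ 2) hp (fun n => (hcg n).pow 2)
      (fun n x => by rw [abs_pow]; exact pow_le_pow_left₀ (abs_nonneg _) (hC n x) 2)
      (fun x => (hlim x).pow 2)
  have l2 := hΘ.tendsto_setIntegral_mul (K := K) (u := fun n x => g n x ^ 2 * Real.log (g n x ^ 2))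
    (v := fun x => f x ^ 2 * Real.log (f x ^ 2)) hp
    (fun n => continuous_sq_mul_log_sq.comp (hcg n)) (fun n x => hK _ (abs_le.1 (hC n x)))
    (fun x => (continuous_sq_mul_log_sq.tendsto _).comp (hlim x))
  have l3 := hΘ.tendsto_setIntegral_mul (K := C ^ 2) (u := fun n x => ‖gradient (g n) x‖ ^ 2)
    (v := fun x => ‖gradient f x‖ ^ 2) hp (fun n => (hcg' n).norm.pow 2)
    (fun n x => by
      rw [abs_pow, abs_norm]; exact pow_le_pow_left₀ (norm_nonneg _) (hC' n x) 2)
    (fun x => (hlim' x).norm.pow 2)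
  refine le_of_tendsto_of_tendsto (l2.sub ((l1.log hN.ne').mul l1)) (l3.const_mul _) ?_
  filter_upwards [l1.eventually_const_lt hN] with n hn
  exact hLSI.entropy_le_of_smooth hΘ hp (hg n) (hgΓ n) hn

/-- **Holley–Stroock perturbation** of a log-Sobolev inequality: if `m p ≤ q ≤ M p`, then `q`
inherits the inequality from `p` up to the factor `M / m`. Here it is written for the relative
entropy of `e ^ g q` with respect to `q`. The reason is that the entropy with respect to a measure
is an infimum over constants `N` of integrals of nonnegative functions, so it is monotone in the
measure. -/
lemma LogSobolev.relativeEntropy_le (hΘ : IsClosedFlatDomain Γ Θ) {p q : E d → ℝ} {lam m M : ℝ}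
    (hLSI : LogSobolev Γ Θ p lam) (hlam : 0 < lam) (hm : 0 < m) (hM : 0 ≤ M)
    (hp : Continuous p) (hq : Continuous q) (hp0 : ∀ x, 0 < p x)
    (hp1 : ∫ x in Θ, p x = 1)
    (hmp : ∀ x, m * p x ≤ q x) (hpM : ∀ x, q x ≤ M * p x) {g : E d → ℝ} (hg : ContDiff ℝ 1 g)
    (hgΓ : IsInvariant Γ g) (hq1 : ∫ x in Θ, q x = 1) (hgq1 : ∫ x in Θ, Real.exp (g x) * q x = 1) :
    ∫ x in Θ, g x * (Real.exp (g x) * q x)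
      ≤ M / m / (2 * lam) * ∫ x in Θ, ‖gradient g x‖ ^ 2 * (Real.exp (g x) * q x) := by
  have hcg := hg.continuous
  have hcg' : Continuous (gradient g) := (contDiff_gradient (m := 0) hg (by norm_num)).continuous
  set f : E d → ℝ := fun x => Real.exp (g x / 2) with hf
  have hf2 : ∀ x, f x ^ 2 = Real.exp (g x) := fun x => by
    rw [hf, ← Real.exp_nat_mul]; congr 1; push_cast; ring
  have hfgrad : ∀ x, ‖gradient f x‖ ^ 2 = 1 / 4 * (‖gradient g x‖ ^ 2 * Real.exp (g x)) :=
    fun x => by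
    have h : HasGradientAt f ((f x / 2) • gradient g x) x := by
      rw [hasGradientAt_iff_hasFDerivAt, map_smul, toDual_gradient]
      have h := ((hg.differentiable one_ne_zero x).hasFDerivAt.mul_const (2⁻¹ : ℝ)).exp
      rw [smul_smul, ← div_eq_mul_inv, ← div_eq_mul_inv] at h
      exact h
    rw [h.gradient, norm_smul, mul_pow, Real.norm_eq_abs, sq_abs, div_pow, hf2]
    ring
  set N := ∫ x in Θ, Real.exp (g x) * p x with hNdef
  have hN : 0 < N := by
    rw [hNdef, setIntegral_pos_iff_support_of_nonneg_ae
      (Eventually.of_forall fun x => (mul_pos (Real.exp_pos _) (hp0 x)).le)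
      (hΘ.integrableOn (by fun_prop))]
    have hsupp : Function.support (fun x => Real.exp (g x) * p x) = univ :=
      Function.support_eq_univ fun x => (mul_pos (Real.exp_pos _) (hp0 x)).ne'
    rw [hsupp, univ_inter]
    exact hΘ.volume_pos
  have hLS := hLSI.entropy_le hΘ hp (f := f) (by fun_prop)
    (fun γ hγ x => by simp only [hf, hgΓ γ hγ]) (by simpa only [hf2] using hN)
  simp only [hf2, Real.log_exp, hfgrad] at hLS
  -- the nonnegative integrand of the variational formula at the constant `N`
  set ψ : E d → ℝ := fun x => g x * Real.exp (g x) - Real.log N * Real.exp (g x)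
    - Real.exp (g x) + N with hψ
  have hcψ : Continuous ψ := by fun_prop
  have hψ0 : ∀ x, 0 ≤ ψ x := fun x => by
    have h := Real.log_le_sub_one_of_pos (mul_pos hN (Real.exp_pos (-g x)))
    rw [Real.log_mul hN.ne' (Real.exp_pos _).ne', Real.log_exp] at h
    have h' := mul_le_mul_of_nonneg_left h (Real.exp_pos (g x)).le
    have he : Real.exp (g x) * Real.exp (-g x) = 1 := by rw [← Real.exp_add]; simp
    have : Real.exp (g x) * (N * Real.exp (-g x) - 1) = N - Real.exp (g x) := by
      linear_combination N * he
    simp only [hψ]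
    linarith
  have hint : ∀ w : E d → ℝ, Continuous w → ∫ x in Θ, ψ x * w x
      = (∫ x in Θ, g x * (Real.exp (g x) * w x)) - Real.log N * (∫ x in Θ, Real.exp (g x) * w x)
        - (∫ x in Θ, Real.exp (g x) * w x) + N * ∫ x in Θ, w x := fun w hw => by
    rw [← integral_const_mul, ← integral_const_mul, ← integral_sub, ← integral_sub, ← integral_add]
    · exact integral_congr_ae (Eventually.of_forall fun x => by simp only [hψ]; ring)
    all_goals exact hΘ.integrableOn (by fun_prop)
  have e1 := hint q hq
  have e2 := hint p hp
  rw [hq1, hgq1] at e1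
  rw [← hNdef, hp1] at e2
  have e3 : ∫ x in Θ, ψ x * q x ≤ M * ∫ x in Θ, ψ x * p x := by
    rw [← integral_const_mul]
    refine integral_mono (hΘ.integrableOn (by fun_prop)) (hΘ.integrableOn (by fun_prop)) fun x => ?_
    have := mul_le_mul_of_nonneg_left (hpM x) (hψ0 x)
    simp only
    linarith
  have e4 : ∫ x in Θ, ‖gradient g x‖ ^ 2 * Real.exp (g x) * p x
      ≤ m⁻¹ * ∫ x in Θ, ‖gradient g x‖ ^ 2 * (Real.exp (g x) * q x) := by
    rw [← integral_const_mul]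
    refine integral_mono (hΘ.integrableOn (by fun_prop)) (hΘ.integrableOn (by fun_prop)) fun x => ?_
    have h : p x ≤ m⁻¹ * q x := by rw [le_inv_mul_iff₀ hm]; exact hmp x
    have := mul_le_mul_of_nonneg_left h
      (mul_nonneg (sq_nonneg ‖gradient g x‖) (Real.exp_pos (g x)).le)
    simp only
    linarith
  have e5 : ∫ x in Θ, 1 / 4 * (‖gradient g x‖ ^ 2 * Real.exp (g x)) * p x
      = 1 / 4 * ∫ x in Θ, ‖gradient g x‖ ^ 2 * Real.exp (g x) * p x := by
    rw [← integral_const_mul]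
    exact integral_congr_ae (Eventually.of_forall fun x => by ring)
  have e6 : ∫ x in Θ, Real.exp (g x) * g x * p x = ∫ x in Θ, g x * (Real.exp (g x) * p x) :=
    integral_congr_ae (Eventually.of_forall fun x => by ring)
  rw [e5, e6, ← hNdef] at hLS
  have e7 := Real.log_le_sub_one_of_pos hN
  calc ∫ x in Θ, g x * (Real.exp (g x) * q x)
      ≤ ∫ x in Θ, ψ x * q x := by linarith
    _ ≤ M * ∫ x in Θ, ψ x * p x := e3
    _ ≤ M * (2 / lam * (1 / 4 * ∫ x in Θ, ‖gradient g x‖ ^ 2 * Real.exp (g x) * p x)) :=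
        mul_le_mul_of_nonneg_left (by linarith) hM
    _ ≤ M * (2 / lam * (1 / 4 * (m⁻¹ * ∫ x in Θ,
          ‖gradient g x‖ ^ 2 * (Real.exp (g x) * q x)))) := by gcongr
    _ = _ := by field_simp; ring

/-! ### Differentiation under the integral sign and the maximum principle -/

namespace IsClosedFlatDomain

variable (hΘ : IsClosedFlatDomain Γ Θ)
include hΘ

lemma exists_bound_slab {f : ℝ → E d → ℝ}
    (hf : ContinuousOn (fun p : ℝ × E d => f p.1 p.2) (Icc 0 T ×ˢ univ)) :
    ∃ C, 0 ≤ C ∧ ∀ t ∈ Icc 0 T, ∀ x ∈ Θ, |f t x| ≤ C := by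
  obtain ⟨C, hC⟩ := (isCompact_Icc.prod hΘ.isCompact_closure).exists_bound_of_continuousOn
    (hf.mono (prod_mono_right (subset_univ _)))
  exact ⟨max C 0, le_max_right _ _, fun t ht x hx =>
    (hC (t, x) ⟨ht, subset_closure hx⟩).trans (le_max_left _ _)⟩

/-- Differentiation under the integral over `Θ`, one-sided at the ends of the time interval. -/
lemma hasDerivWithinAt_setIntegral {f f' : ℝ → E d → ℝ}
    (hfc : ∀ t ∈ Icc 0 T, Continuous (f t))
    (hf : ∀ t ∈ Icc 0 T, ∀ x, HasDerivWithinAt (fun s => f s x) (f' t x) (Icc 0 T) t)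
    (hf' : ContinuousOn (fun p : ℝ × E d => f' p.1 p.2) (Icc 0 T ×ˢ univ))
    {t : ℝ} (ht : t ∈ Icc 0 T) :
    HasDerivWithinAt (fun s => ∫ x in Θ, f s x) (∫ x in Θ, f' t x) (Icc 0 T) t := by
  obtain ⟨C, -, hC⟩ := hΘ.exists_bound_slab hf'
  rw [hasDerivWithinAt_iff_tendsto_slope]
  have hmem : ∀ᶠ s in 𝓝[Icc 0 T \ {t}] t, s ∈ Icc 0 T :=
    eventually_nhdsWithin_of_forall fun s hs => hs.1
  have hlim : Tendsto (fun s => ∫ x in Θ, slope (fun r => f r x) t s) (𝓝[Icc 0 T \ {t}] t)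
      (𝓝 (∫ x in Θ, f' t x)) := by
    refine tendsto_integral_filter_of_dominated_convergence (fun _ => C) ?_ ?_
      (hΘ.integrableOn continuous_const) ?_
    · filter_upwards [hmem] with s hs
      simp only [slope_def_field]
      exact (((hfc s hs).sub (hfc t ht)).div_const _).aestronglyMeasurable
    · filter_upwards [hmem] with s hs
      refine (ae_restrict_iff' hΘ.measurableSet).2 (Eventually.of_forall fun x hx => ?_)
      have h := (convex_Icc 0 T).norm_image_sub_le_of_norm_hasDerivWithin_le
        (fun r hr => hf r hr x) (fun r hr => hC r hr x hx) ht hs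
      rw [slope_def_field, norm_div]
      exact div_le_of_le_mul₀ (norm_nonneg _) ((abs_nonneg _).trans (hC t ht x hx)) h
    · exact Eventually.of_forall fun x => hasDerivWithinAt_iff_tendsto_slope.1 (hf t ht x)
  refine hlim.congr' ?_
  filter_upwards [hmem] with s hs
  simp only [slope_def_field]
  rw [integral_div, integral_sub (hΘ.integrableOn (hfc s hs)) (hΘ.integrableOn (hfc t ht))]

end IsClosedFlatDomain

/-- **Parabolic maximum principle**: if the time derivative is nonpositive wherever `z t` is
maximal in space, then the maximum does not increase. -/
lemma le_of_timeDeriv_nonpos_at_max {X : Type*} [TopologicalSpace X] {K : Set X} (hK : IsCompact K)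
    {z z' : ℝ → X → ℝ} (hz : ContinuousOn (fun p : ℝ × X => z p.1 p.2) (Icc 0 T ×ˢ K))
    (hz' : ∀ t ∈ Icc 0 T, ∀ x ∈ K, HasDerivWithinAt (fun s => z s x) (z' t x) (Icc 0 T) t)
    (hmax : ∀ t ∈ Icc 0 T, ∀ x ∈ K, (∀ y ∈ K, z t y ≤ z t x) → z' t x ≤ 0)
    {M : ℝ} (h0 : ∀ x ∈ K, z 0 x ≤ M) {t : ℝ} (ht : t ∈ Icc 0 T) {x : X} (hx : x ∈ K) :
    z t x ≤ M := by
  have key : ∀ ε > 0, z t x ≤ M + ε * t := fun ε hε => by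
    -- the maximum of `z - ε t` over the space-time slab cannot be attained at a positive time
    obtain ⟨⟨t₀, x₀⟩, ⟨ht₀, hx₀⟩, hm⟩ := (isCompact_Icc.prod hK).exists_isMaxOn
      ⟨(t, x), ⟨ht, hx⟩⟩ (f := fun p : ℝ × X => z p.1 p.2 - ε * p.1) (by fun_prop)
    have hle : ∀ s ∈ Icc 0 T, ∀ y ∈ K, z s y - ε * s ≤ z t₀ x₀ - ε * t₀ := fun s hs y hy =>
      hm (a := (s, y)) ⟨hs, hy⟩
    rcases (show 0 ≤ t₀ from ht₀.1).eq_or_lt with h | hpos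
    · have h1 := hle t ht x hx
      have h2 := h0 x₀ hx₀
      rw [← h] at h1
      linarith
    · exfalso
      have hn := hmax t₀ ht₀ x₀ hx₀ fun y hy => by linarith [hle t₀ ht₀ y hy]
      have hd : HasDerivWithinAt (fun s => z s x₀ - ε * s) (z' t₀ x₀ - ε * 1) (Iio t₀) t₀ :=
        ((hz' t₀ ht₀ x₀ hx₀).sub ((hasDerivWithinAt_id t₀ _).const_mul ε)).mono_of_mem_nhdsWithin
          (mem_of_superset (Ico_mem_nhdsLT hpos) fun s hs => ⟨hs.1, hs.2.le.trans ht₀.2⟩)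
      rw [hasDerivWithinAt_iff_tendsto_slope' self_notMem_Iio] at hd
      have : 0 ≤ z' t₀ x₀ - ε * 1 := by
        refine ge_of_tendsto hd ?_
        filter_upwards [Ico_mem_nhdsLT hpos] with s hs
        rw [slope_def_field]
        refine div_nonneg_of_nonpos ?_ (by linarith [hs.2])
        linarith [hle s ⟨hs.1, hs.2.le.trans ht₀.2⟩ x₀ hx₀]
      linarith
  have hlim : Tendsto (fun ε : ℝ => M + ε * t) (𝓝[>] 0) (𝓝 (M + 0 * t)) :=
    Tendsto.mono_left (Continuous.tendsto (by fun_prop) 0) nhdsWithin_le_nhds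
  rw [zero_mul, add_zero] at hlim
  exact ge_of_tendsto hlim (eventually_nhdsWithin_of_forall key)

/-- At a maximum of `w`, the weighted Laplacian `∇ · (a ∇w)` with `a > 0` is nonpositive. -/
lemma divergence_nonpos_of_forall_le {w a : E d → ℝ} {F : E d → E d} (hw : Differentiable ℝ w)
    (ha : ∀ x, 0 < a x) (hFw : ∀ x, F x = a x • gradient w x) {x₀ : E d}
    (hF : DifferentiableAt ℝ F x₀) (hmax : ∀ x, w x ≤ w x₀) : divergence F x₀ ≤ 0 := by
  refine Finset.sum_nonpos fun i _ => ?_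
  by_contra! hpos
  -- a positive `i`-th diagonal entry of `DF` makes `w` strictly increasing along `x₀ + s eᵢ`
  set e : E d := EuclideanSpace.single i 1
  have hline : ∀ s : ℝ, HasDerivAt (fun s : ℝ => x₀ + s • e) e s := fun s => by
    simpa using ((hasDerivAt_id s).smul_const e).const_add x₀
  have hu : ∀ s : ℝ, HasDerivAt (fun s : ℝ => w (x₀ + s • e)) (fderiv ℝ w (x₀ + s • e) e) s :=
    fun s => (hw _).hasFDerivAt.comp_hasDerivAt s (hline s)
  have hφ : HasDerivAt (fun s : ℝ => F (x₀ + s • e) i) ((fderiv ℝ F x₀ e) i) 0 := by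
    have h1 : HasFDerivAt F (fderiv ℝ F x₀) (x₀ + (0 : ℝ) • e) := by simpa using hF.hasFDerivAt
    exact (EuclideanSpace.proj i : E d →L[ℝ] ℝ).hasFDerivAt.comp_hasDerivAt (0 : ℝ)
      (h1.comp_hasDerivAt 0 (hline 0))
  have hF0 : F x₀ = 0 := by
    have h1 : IsLocalMax w x₀ := Eventually.of_forall hmax
    have h2 : gradient w x₀ = 0 := by
      simp [gradient, h1.fderiv_eq_zero]
    rw [hFw, h2, smul_zero]
  rw [hasDerivAt_iff_tendsto_slope] at hφ
  have h3 : ∀ᶠ s in 𝓝[>] (0 : ℝ), 0 < F (x₀ + s • e) i := by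
    have h4 := (hφ.mono_left (nhdsWithin_mono 0 fun s (hs : 0 < s) => hs.ne'))
      |>.eventually_const_lt hpos
    filter_upwards [h4, self_mem_nhdsWithin] with s hs hs0
    rw [slope_def_field] at hs
    simp only [zero_smul, add_zero, hF0, PiLp.zero_apply, sub_zero] at hs
    exact (div_pos_iff_of_pos_right hs0).1 hs
  obtain ⟨δ, hδ, hδ'⟩ := mem_nhdsGT_iff_exists_Ioo_subset.1 h3
  have hδ0 : (0 : ℝ) < δ := hδ
  have hmono : StrictMonoOn (fun s : ℝ => w (x₀ + s • e)) (Icc 0 (δ / 2)) := by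
    refine strictMonoOn_of_deriv_pos (convex_Icc _ _)
      (fun s _ => (hu s).continuousAt.continuousWithinAt) fun s hs => ?_
    rw [interior_Icc] at hs
    have h5 : 0 < F (x₀ + s • e) i := hδ' ⟨hs.1, by linarith [hs.2]⟩
    rw [hFw] at h5
    simp only [PiLp.smul_apply, smul_eq_mul] at h5
    have h6 : fderiv ℝ w (x₀ + s • e) e = gradient w (x₀ + s • e) i := by
      rw [← inner_gradient_left, EuclideanSpace.inner_single_right]
      simp
    rw [(hu s).deriv, h6]
    exact pos_of_mul_pos_right h5 (ha _).le
  have := hmono ⟨le_rfl, by linarith⟩ ⟨by linarith, le_rfl⟩ (by linarith : (0 : ℝ) < δ / 2)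
  simp only [zero_smul, add_zero] at this
  exact absurd (hmax _) (not_le.2 this)

/-! ### The Gibbs density and the log-density of a solution -/

namespace IsClosedFlatDomain

variable (hΘ : IsClosedFlatDomain Γ Θ)
include hΘ

lemma setIntegral_pos {f : E d → ℝ} (hc : Continuous f) (hf : ∀ x, 0 < f x) :
    0 < ∫ x in Θ, f x := by
  rw [setIntegral_pos_iff_support_of_nonneg_ae (Eventually.of_forall fun x => (hf x).le)
    (hΘ.integrableOn hc), Function.support_eq_univ fun x => (hf x).ne', univ_inter]
  exact hΘ.volume_pos

lemma partition_pos {V : E d → ℝ} (hV : Continuous V) : 0 < ∫ y in Θ, Real.exp (-V y) :=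
  hΘ.setIntegral_pos (by fun_prop) fun _ => Real.exp_pos _

lemma gibbs_pos {V : E d → ℝ} (hV : Continuous V) (x : E d) : 0 < gibbs Θ V x :=
  div_pos (Real.exp_pos _) (hΘ.partition_pos hV)

lemma setIntegral_gibbs {V : E d → ℝ} (hV : Continuous V) : ∫ x in Θ, gibbs Θ V x = 1 := by
  simp only [gibbs]
  rw [integral_div, div_self (hΘ.partition_pos hV).ne']

lemma log_gibbs {V : E d → ℝ} (hV : Continuous V) (x : E d) :
    Real.log (gibbs Θ V x) = -V x - Real.log (∫ y in Θ, Real.exp (-V y)) := by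
  rw [gibbs, Real.log_div (Real.exp_pos _).ne' (hΘ.partition_pos hV).ne', Real.log_exp]

end IsClosedFlatDomain

lemma continuous_gibbs {V : E d → ℝ} (hV : Continuous V) : Continuous (gibbs Θ V) := by
  unfold gibbs
  fun_prop

/-- The logarithm `log ρ - log π` of a density `ρ` relative to the Gibbs density `π` of `V`. -/
def logDensity (Θ : Set (E d)) (V ρ : E d → ℝ) (x : E d) : ℝ :=
  Real.log (ρ x) - Real.log (gibbs Θ V x)

lemma rate_eq (V ρ : E d → ℝ) (x : E d) :
    rate Θ V ρ x = logDensity Θ V ρ x - ∫ y in Θ, logDensity Θ V ρ y * ρ y := rfl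

section LogDensity

variable (hΘ : IsClosedFlatDomain Γ Θ) {V ρ : E d → ℝ} (hV : ContDiff ℝ 2 V) (hρ : ContDiff ℝ 2 ρ)
  (hpos : ∀ x, 0 < ρ x)
include hΘ hV

lemma logDensity_eq (x : E d) : logDensity Θ V ρ x
    = Real.log (ρ x) + V x + Real.log (∫ y in Θ, Real.exp (-V y)) := by
  rw [logDensity, hΘ.log_gibbs hV.continuous]
  ring

include hρ hpos

lemma contDiff_logDensity : ContDiff ℝ 2 (logDensity Θ V ρ) := by
  have h : logDensity Θ V ρ = fun x => Real.log (ρ x) + V x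
      + Real.log (∫ y in Θ, Real.exp (-V y)) := funext fun x => logDensity_eq hΘ hV x
  rw [h]
  exact ((hρ.log fun x => (hpos x).ne').add hV).add contDiff_const

/-- The flux of the transport equation is `ρ ∇ log (ρ / π)`. -/
lemma smul_gradient_logDensity (x : E d) :
    ρ x • gradient (logDensity Θ V ρ) x = gradient ρ x + ρ x • gradient V x := by
  have h1 : HasGradientAt (logDensity Θ V ρ) ((ρ x)⁻¹ • gradient ρ x + gradient V x) x := by
    rw [hasGradientAt_iff_hasFDerivAt, map_add, map_smul, toDual_gradient, toDual_gradient]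
    have h2 := (((hρ.differentiable two_ne_zero x).hasFDerivAt.log (hpos x).ne').add
      (hV.differentiable two_ne_zero x).hasFDerivAt).add_const
        (Real.log (∫ y in Θ, Real.exp (-V y)))
    exact h2.congr_of_eventuallyEq (Eventually.of_forall fun y => logDensity_eq hΘ hV y)
  rw [h1.gradient, smul_add, smul_inv_smul₀ (hpos x).ne']

lemma contDiff_flux : ContDiff ℝ 1 fun x => ρ x • gradient (logDensity Θ V ρ) x :=
  (hρ.of_le one_le_two).smul
    (contDiff_gradient (contDiff_logDensity hΘ hV hρ hpos) (by norm_num))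

end LogDensity

lemma IsInvariant.gibbs {V : E d → ℝ} (hV : IsInvariant Γ V) : IsInvariant Γ (gibbs Θ V) :=
  fun γ hγ x => by simp only [SHK.gibbs, hV γ hγ]

lemma IsInvariant.logDensity {V ρ : E d → ℝ} (hV : IsInvariant Γ V) (hρ : IsInvariant Γ ρ) :
    IsInvariant Γ (logDensity Θ V ρ) :=
  fun γ hγ x => by simp only [SHK.logDensity, hρ γ hγ, hV.gibbs γ hγ]

namespace IsPositiveSolution

variable {V : E d → ℝ} {ρ : ℝ → E d → ℝ}

section Basic

variable (hs : IsPositiveSolution Γ Θ V T ρ)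
include hs

lemma hasDerivWithinAt {t : ℝ} (ht : t ∈ Icc 0 T) (x : E d) :
    HasDerivWithinAt (fun s => ρ s x) (timeDeriv T ρ t x) (Icc 0 T) t :=
  (hs.isC12.differentiableOn_time x t ht).hasDerivWithinAt

lemma continuous_slice {t : ℝ} (ht : t ∈ Icc 0 T) : Continuous (ρ t) :=
  (hs.isC12.contDiff_space t ht).continuous

lemma ne_zero {t : ℝ} (ht : t ∈ Icc 0 T) (x : E d) : ρ t x ≠ 0 := (hs.pos t ht x).ne'

lemma continuousOn_log :
    ContinuousOn (fun p : ℝ × E d => Real.log (ρ p.1 p.2)) (Icc 0 T ×ˢ univ) :=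
  hs.isC12.continuousOn.log fun p hp => hs.ne_zero hp.1 p.2

end Basic

variable (hs : IsPositiveSolution Γ Θ V T ρ) (hΘ : IsClosedFlatDomain Γ Θ) (hV : ContDiff ℝ 2 V)
  (hVΓ : IsInvariant Γ V)
include hs hΘ hV

lemma timeDeriv_eq {t : ℝ} (ht : t ∈ Icc 0 T) (x : E d) :
    timeDeriv T ρ t x
      = divergence (fun y => ρ t y • gradient (logDensity Θ V (ρ t)) y) x
        - rate Θ V (ρ t) x * ρ t x := by
  rw [hs.equation t ht x]
  congr 2
  exact funext fun y =>
    (smul_gradient_logDensity hΘ hV (hs.isC12.contDiff_space t ht) (hs.pos t ht) y).symm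

lemma contDiff_logDensity {t : ℝ} (ht : t ∈ Icc 0 T) : ContDiff ℝ 2 (logDensity Θ V (ρ t)) :=
  SHK.contDiff_logDensity hΘ hV (hs.isC12.contDiff_space t ht) (hs.pos t ht)

lemma contDiff_flux {t : ℝ} (ht : t ∈ Icc 0 T) :
    ContDiff ℝ 1 fun x => ρ t x • gradient (logDensity Θ V (ρ t)) x :=
  SHK.contDiff_flux hΘ hV (hs.isC12.contDiff_space t ht) (hs.pos t ht)

lemma continuousOn_logDensity :
    ContinuousOn (fun p : ℝ × E d => logDensity Θ V (ρ p.1) p.2) (Icc 0 T ×ˢ univ) := by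
  have hc := hV.continuous
  refine ((hs.continuousOn_log.add (hc.comp continuous_snd).continuousOn).add_const
    (Real.log (∫ y in Θ, Real.exp (-V y)))).congr fun p _ => logDensity_eq hΘ hV p.2

include hVΓ

lemma isEquivariant_flux {t : ℝ} (ht : t ∈ Icc 0 T) :
    IsEquivariant Γ fun x => ρ t x • gradient (logDensity Θ V (ρ t)) x :=
  ((hVΓ.logDensity (hs.isInvariant t ht)).gradient
    ((hs.contDiff_logDensity hΘ hV ht).differentiable two_ne_zero)).smul (hs.isInvariant t ht)

/-- Integrated form of the equation against a test function. -/
lemma setIntegral_mul_timeDeriv {t : ℝ} (ht : t ∈ Icc 0 T) {φ : E d → ℝ} (hφ : ContDiff ℝ 1 φ)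
    (hφΓ : IsInvariant Γ φ) :
    ∫ x in Θ, φ x * timeDeriv T ρ t x
      = -(∫ x in Θ, ⟪gradient φ x, gradient (logDensity Θ V (ρ t)) x⟫ * ρ t x)
        - ∫ x in Θ, φ x * (rate Θ V (ρ t) x * ρ t x) := by
  have hcφ := hφ.continuous
  have hcρ := hs.continuous_slice ht
  have hcw := (hs.contDiff_logDensity hΘ hV ht).continuous
  have hcd := continuous_divergence (hs.contDiff_flux hΘ hV ht)
  have hcr : Continuous (rate Θ V (ρ t)) := hcw.sub continuous_const
  have h := hΘ.setIntegral_mul_divergence hφ hφΓ (hs.contDiff_flux hΘ hV ht)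
    (hs.isEquivariant_flux hΘ hV hVΓ ht)
  simp only [inner_smul_right] at h
  simp only [hs.timeDeriv_eq hΘ hV ht, mul_sub]
  rw [integral_sub (hΘ.integrableOn (by fun_prop)) (hΘ.integrableOn (by fun_prop)), h]
  simp only [mul_comm]

/-- The birth-death term is centered, so the mass obeys a linear homogeneous equation. -/
lemma setIntegral_timeDeriv {t : ℝ} (ht : t ∈ Icc 0 T) :
    ∫ x in Θ, timeDeriv T ρ t x
      = (∫ x in Θ, logDensity Θ V (ρ t) x * ρ t x) * ((∫ x in Θ, ρ t x) - 1) := by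
  have h := hs.setIntegral_mul_timeDeriv hΘ hV hVΓ ht (φ := fun _ => 1) contDiff_const
    (fun _ _ _ => rfl)
  have hcρ := hs.continuous_slice ht
  have hcw := (hs.contDiff_logDensity hΘ hV ht).continuous
  have hg : ∀ x : E d, gradient (fun _ : E d => (1 : ℝ)) x = 0 := fun x => by simp [gradient]
  simp only [one_mul, hg, inner_zero_left, zero_mul, integral_zero, rate_eq, sub_mul] at h
  rw [h, integral_sub (hΘ.integrableOn (by fun_prop)) (hΘ.integrableOn (by fun_prop)),
    integral_const_mul]
  ring

lemma mass_eq_one {t : ℝ} (ht : t ∈ Icc 0 T) : ∫ x in Θ, ρ t x = 1 := by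
  obtain ⟨C, hC0, hC⟩ := hΘ.exists_bound_slab
    (f := fun t x => logDensity Θ V (ρ t) x * ρ t x)
    ((hs.continuousOn_logDensity hΘ hV).mul hs.isC12.continuousOn)
  have hd : ∀ s ∈ Icc 0 T, HasDerivWithinAt (fun s => (∫ x in Θ, ρ s x) - 1)
      (∫ x in Θ, timeDeriv T ρ s x) (Icc 0 T) s := fun s hs' =>
    (hΘ.hasDerivWithinAt_setIntegral (fun r hr => hs.continuous_slice hr)
      (fun r hr x => hs.hasDerivWithinAt hr x) hs.isC12.continuousOn_timeDeriv hs').sub_const 1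
  have h := norm_le_gronwallBound_of_norm_deriv_right_le (δ := 0) (ε := 0)
    (K := C * volume.real Θ)
    (fun s hs' => (hd s hs').continuousWithinAt)
    (fun s hs' => (hd s (Ico_subset_Icc_self hs')).mono_of_mem_nhdsWithin
      (mem_of_superset (Icc_mem_nhdsGE hs'.2) (Icc_subset_Icc_left hs'.1)))
    (by rw [hs.initial_mass, sub_self, norm_zero])
    (fun s hs' => by
      rw [hs.setIntegral_timeDeriv hΘ hV hVΓ (Ico_subset_Icc_self hs'), norm_mul, add_zero]
      refine mul_le_mul_of_nonneg_right ?_ (norm_nonneg _)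
      exact norm_setIntegral_le_of_norm_le_const hΘ.measure_lt_top
        fun x hx => hC s (Ico_subset_Icc_self hs') x hx) t ht
  rw [gronwallBound_ε0_δ0] at h
  exact sub_eq_zero.1 (norm_le_zero_iff.1 h)

/-- The oscillation of `log (ρ / π)` decays exponentially. The maximum principle is applied to the
two-point function `e ^ t (w t x - w t y)`, from which the centering of the rate drops out. -/
lemma logDensity_sub_le {t : ℝ} (ht : t ∈ Icc 0 T) (x y : E d) :
    logDensity Θ V (ρ t) x - logDensity Θ V (ρ t) y
      ≤ Real.exp (-t) * osc (logDensity Θ V (ρ 0)) := by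
  have hT : (0 : ℝ) ∈ Icc 0 T := ⟨le_rfl, ht.1.trans ht.2⟩
  set w : ℝ → E d → ℝ := fun t => logDensity Θ V (ρ t) with hw
  have hwΓ : ∀ s ∈ Icc 0 T, IsInvariant Γ (w s) := fun s hs' =>
    hVΓ.logDensity (hs.isInvariant s hs')
  have hwd : ∀ s ∈ Icc 0 T, Differentiable ℝ (w s) := fun s hs' =>
    (hs.contDiff_logDensity hΘ hV hs').differentiable two_ne_zero
  have hwc : ContinuousOn (fun p : ℝ × E d => w p.1 p.2) (Icc 0 T ×ˢ univ) :=
    hs.continuousOn_logDensity hΘ hV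
  have hwt : ∀ s ∈ Icc 0 T, ∀ x, HasDerivWithinAt (fun r => w r x)
      (timeDeriv T ρ s x / ρ s x) (Icc 0 T) s := fun s hs' x =>
    ((hs.hasDerivWithinAt hs' x).log (hs.ne_zero hs' x)).sub_const _
  obtain ⟨γ, hγ, hγx⟩ := hΘ.exists_mem x
  obtain ⟨δ, hδ, hδy⟩ := hΘ.exists_mem y
  have h := le_of_timeDeriv_nonpos_at_max (T := T) (X := E d × E d)
    (K := closure Θ ×ˢ closure Θ) (hΘ.isCompact_closure.prod hΘ.isCompact_closure)
    (z := fun t p => Real.exp t * (w t p.1 - w t p.2))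
    (z' := fun t p => Real.exp t * (w t p.1 - w t p.2)
      + Real.exp t * (timeDeriv T ρ t p.1 / ρ t p.1 - timeDeriv T ρ t p.2 / ρ t p.2))
    (by
      have c1 : ContinuousOn (fun q : ℝ × E d × E d => w q.1 q.2.1)
          (Icc 0 T ×ˢ closure Θ ×ˢ closure Θ) :=
        hwc.comp (f := fun q : ℝ × E d × E d => (q.1, q.2.1)) (by fun_prop)
          fun q hq => ⟨hq.1, mem_univ _⟩
      have c2 : ContinuousOn (fun q : ℝ × E d × E d => w q.1 q.2.2)
          (Icc 0 T ×ˢ closure Θ ×ˢ closure Θ) :=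
        hwc.comp (f := fun q : ℝ × E d × E d => (q.1, q.2.2)) (by fun_prop)
          fun q hq => ⟨hq.1, mem_univ _⟩
      exact (Real.continuous_exp.comp continuous_fst).continuousOn.mul (c1.sub c2))
    (fun s hs' p _ => (Real.hasDerivAt_exp s).hasDerivWithinAt.mul
      ((hwt s hs' p.1).sub (hwt s hs' p.2)))
    (by
      rintro s hs' ⟨x, y⟩ ⟨hx, hy⟩ hm
      have hle : ∀ x' ∈ closure Θ, ∀ y' ∈ closure Θ, w s x' - w s y' ≤ w s x - w s y :=
        fun x' hx' y' hy' => le_of_mul_le_mul_left (hm (x', y') ⟨hx', hy'⟩) (Real.exp_pos s)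
      have hmax : ∀ x', w s x' ≤ w s x := fun x' => by
        obtain ⟨γ, hγ, hγx⟩ := hΘ.exists_mem x'
        rw [← hwΓ s hs' γ hγ x']
        linarith [hle _ (subset_closure hγx) y hy]
      have hmin : ∀ y', w s y ≤ w s y' := fun y' => by
        obtain ⟨γ, hγ, hγy⟩ := hΘ.exists_mem y'
        rw [← hwΓ s hs' γ hγ y']
        linarith [hle x hx _ (subset_closure hγy)]
      have hF := (hs.contDiff_flux hΘ hV hs').differentiable one_ne_zero
      have d1 := divergence_nonpos_of_forall_le (hwd s hs') (hs.pos s hs') (fun _ => rfl)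
        (hF x) hmax
      have d2 := divergence_nonpos_of_forall_le (w := fun x => -w s x)
        (F := fun x => -(ρ s x • gradient (w s) x)) (hwd s hs').neg (hs.pos s hs')
        (fun z => by
          have : gradient (fun x => -w s x) z = -gradient (w s) z := by
            simp only [gradient, fderiv_fun_neg, map_neg]
          rw [this, smul_neg])
        (hF y).neg (fun y' => neg_le_neg (hmin y'))
      have d3 : divergence (fun x => -(ρ s x • gradient (w s) x)) y
          = -divergence (fun x => ρ s x • gradient (w s) x) y := by
        simp only [divergence, fderiv_fun_neg]
        simp
      rw [d3] at d2
      have q1 := div_nonpos_of_nonpos_of_nonneg d1 (hs.pos s hs' x).le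
      have q2 := div_nonneg (neg_nonpos.1 d2) (hs.pos s hs' y).le
      have hq : ∀ z, timeDeriv T ρ s z / ρ s z
          = divergence (fun x => ρ s x • gradient (w s) x) z / ρ s z
            - (w s z - ∫ y in Θ, w s y * ρ s y) := fun z => by
        rw [hs.timeDeriv_eq hΘ hV hs', sub_div, mul_div_cancel_right₀ _ (hs.ne_zero hs' z), rate_eq]
      simp only [hq]
      have := mul_nonpos_of_nonneg_of_nonpos (Real.exp_pos s).le (sub_nonpos.2 (q1.trans q2))
      linarith)
    (M := osc (w 0))
    (fun p _ => by
      rw [Real.exp_zero, one_mul]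
      exact hΘ.sub_le_osc (hwd 0 hT).continuous (hwΓ 0 hT) _ _)
    ht (x := (γ x, δ y)) ⟨subset_closure hγx, subset_closure hδy⟩
  simp only [hwΓ t ht γ hγ, hwΓ t ht δ hδ] at h
  rw [Real.exp_neg, le_inv_mul_iff₀ (Real.exp_pos t)]
  exact h

end IsPositiveSolution

/-! ### Covariance estimates for functions of bounded oscillation -/

namespace IsClosedFlatDomain

variable (hΘ : IsClosedFlatDomain Γ Θ)
include hΘ

/-- A function with oscillation at most `a` stays within `a / 2` of its midrange. -/
lemma exists_abs_sub_le {w : E d → ℝ} (hw : Continuous w) (hwΓ : IsInvariant Γ w) {a : ℝ}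
    (ha : ∀ x y, w x - w y ≤ a) : ∃ k, ∀ x, |w x - k| ≤ a / 2 := by
  obtain ⟨x₁, h1⟩ := hΘ.exists_forall_le hw hwΓ
  obtain ⟨x₂, h2⟩ := hΘ.exists_forall_le (f := fun x => -w x) hw.neg
    (fun γ hγ x => by simp only [hwΓ γ hγ])
  refine ⟨(w x₁ + w x₂) / 2, fun x => abs_le.2 ⟨?_, ?_⟩⟩ <;>
    linarith [h1 x, h2 x, ha x₁ x₂]

variable {q : E d → ℝ} (hq : Continuous q) (hq0 : ∀ x, 0 ≤ q x) (hq1 : ∫ x in Θ, q x = 1)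
include hq hq0 hq1

lemma setIntegral_mul_le {u : E d → ℝ} (hu : Continuous u) {C : ℝ} (hC : ∀ x, u x ≤ C) :
    ∫ x in Θ, u x * q x ≤ C := by
  calc ∫ x in Θ, u x * q x ≤ ∫ x in Θ, C * q x :=
        integral_mono (hΘ.integrableOn (by fun_prop)) (hΘ.integrableOn (by fun_prop))
          fun x => mul_le_mul_of_nonneg_right (hC x) (hq0 x)
    _ = C := by rw [integral_const_mul, hq1, mul_one]

/-- The mean absolute deviation of a function of oscillation at most `a` is at most `a / 2`, by
Popoviciu's bound on the variance. -/
lemma setIntegral_abs_sub_mean_le {w : E d → ℝ} (hw : Continuous w) (hwΓ : IsInvariant Γ w) {a : ℝ}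
    (ha : ∀ x y, w x - w y ≤ a) :
    ∫ x in Θ, |w x - ∫ y in Θ, w y * q y| * q x ≤ a / 2 := by
  obtain ⟨k, hk⟩ := hΘ.exists_abs_sub_le hw hwΓ ha
  have ha0 : 0 ≤ a / 2 := (abs_nonneg _).trans (hk 0)
  set m := ∫ y in Θ, w y * q y with hm
  set s := ∫ x in Θ, |w x - m| * q x with hs
  have h1 : ∫ x in Θ, (w x - k) ^ 2 * q x ≤ (a / 2) ^ 2 :=
    hΘ.setIntegral_mul_le hq hq0 hq1 (by fun_prop) fun x => by
      rw [← sq_abs]; exact pow_le_pow_left₀ (abs_nonneg _) (hk x) 2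
  have h2 : ∫ x in Θ, (w x - k) ^ 2 * q x
      = (∫ x in Θ, (w x - m) ^ 2 * q x) + (m - k) ^ 2 := by
    have : ∀ x, (w x - k) ^ 2 * q x = (w x - m) ^ 2 * q x
        + (2 * (m - k) * (w x * q x) + (k ^ 2 - m ^ 2) * q x) := fun x => by ring
    simp only [this]
    rw [integral_add (hΘ.integrableOn (by fun_prop)) (hΘ.integrableOn (by fun_prop)),
      integral_add (hΘ.integrableOn (by fun_prop)) (hΘ.integrableOn (by fun_prop)),
      integral_const_mul, integral_const_mul, hq1, ← hm]
    ring
  have h3 : 0 ≤ ∫ x in Θ, (|w x - m| - s) ^ 2 * q x :=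
    integral_nonneg fun x => mul_nonneg (sq_nonneg _) (hq0 x)
  -- the variance of `|w - m|` is nonnegative, so `s ^ 2` is at most the variance of `w`
  have h4 : ∫ x in Θ, (|w x - m| - s) ^ 2 * q x = (∫ x in Θ, (w x - m) ^ 2 * q x) - s ^ 2 := by
    have : ∀ x, (|w x - m| - s) ^ 2 * q x = (w x - m) ^ 2 * q x
        + (-(2 * s) * (|w x - m| * q x) + s ^ 2 * q x) := fun x => by
      rw [← sq_abs (w x - m)]; ring
    simp only [this]
    rw [integral_add (hΘ.integrableOn (by fun_prop)) (hΘ.integrableOn (by fun_prop)),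
      integral_add (hΘ.integrableOn (by fun_prop)) (hΘ.integrableOn (by fun_prop)),
      integral_const_mul, integral_const_mul, hq1, ← hs]
    ring
  exact le_of_sq_le_sq (by nlinarith [sq_nonneg (m - k)]) ha0

/-- The contribution `-Cov (w, w - w' + σ)` of the birth-death term: the variance of `w` absorbs
its covariance with `w'` up to a quarter of the variance of `w'`. -/
lemma neg_covariance_le {w w' σ : E d → ℝ} (hw : Continuous w) (hwΓ : IsInvariant Γ w)
    (hw' : Continuous w') (hwΓ' : IsInvariant Γ w') (hσ : Continuous σ) {a a' S : ℝ}
    (ha : ∀ x y, w x - w y ≤ a) (ha' : ∀ x y, w' x - w' y ≤ a') (hS : ∀ x, |σ x| ≤ S) :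
    -(∫ x in Θ, (w x - w' x + σ x) * ((w x - ∫ y in Θ, w y * q y) * q x))
      ≤ a' ^ 2 / 16 + S * (a / 2) := by
  obtain ⟨k, hk⟩ := hΘ.exists_abs_sub_le hw' hwΓ' ha'
  have hS0 : 0 ≤ S := (abs_nonneg _).trans (hS 0)
  have hmad := hΘ.setIntegral_abs_sub_mean_le hq hq0 hq1 hw hwΓ ha
  set m := ∫ y in Θ, w y * q y with hm
  have hcent : ∫ x in Θ, (w x - m) * q x = 0 := by
    simp only [sub_mul]
    rw [integral_sub (hΘ.integrableOn (by fun_prop)) (hΘ.integrableOn (by fun_prop)),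
      integral_const_mul, hq1, ← hm]
    ring
  -- `w - m` is centered, so `w'` may be shifted by its midrange `k` before completing the square
  have hpt : ∀ x, -((w x - w' x + σ x) * ((w x - m) * q x))
      ≤ (k - m) * ((w x - m) * q x) + (a' ^ 2 / 16 * q x + S * (|w x - m| * q x)) := fun x => by
    have h1 : (w' x - k) ^ 2 ≤ (a' / 2) ^ 2 := by
      rw [← sq_abs]; exact pow_le_pow_left₀ (abs_nonneg _) (hk x) 2
    have h2 : -(σ x * (w x - m)) ≤ S * |w x - m| := by
      refine (neg_le_abs _).trans ?_
      rw [abs_mul]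
      exact mul_le_mul_of_nonneg_right (hS x) (abs_nonneg _)
    have h3 : -((w x - w' x + σ x) * (w x - m))
        ≤ (k - m) * (w x - m) + (a' ^ 2 / 16 + S * |w x - m|) := by
      nlinarith [sq_nonneg (w x - m - (w' x - k) / 2)]
    have := mul_le_mul_of_nonneg_right h3 (hq0 x)
    linarith
  have hint : -(∫ x in Θ, (w x - w' x + σ x) * ((w x - m) * q x))
      ≤ ∫ x in Θ, ((k - m) * ((w x - m) * q x)
          + (a' ^ 2 / 16 * q x + S * (|w x - m| * q x))) := by
    rw [← integral_neg]
    exact integral_mono (hΘ.integrableOn (by fun_prop)) (hΘ.integrableOn (by fun_prop)) hpt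
  rw [integral_add (hΘ.integrableOn (by fun_prop)) (hΘ.integrableOn (by fun_prop)),
    integral_add (hΘ.integrableOn (by fun_prop)) (hΘ.integrableOn (by fun_prop)),
    integral_const_mul, integral_const_mul, integral_const_mul, hq1, hcent] at hint
  have := mul_le_mul_of_nonneg_left hmad hS0
  linarith

end IsClosedFlatDomain

/-! ### The entropy production -/

/-- The log-ratio `log ρ - log ρ'` of two densities. -/
def logRatio (p q : E d → ℝ) (x : E d) : ℝ := Real.log (p x) - Real.log (q x)

section TwoSolutions

variable {V V' : E d → ℝ} {ρ ρ' : ℝ → E d → ℝ} (hΘ : IsClosedFlatDomain Γ Θ)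
  (hs : IsPositiveSolution Γ Θ V T ρ) (hs' : IsPositiveSolution Γ Θ V' T ρ')

lemma logRatio_eq (V V' p q : E d → ℝ) (x : E d) :
    logRatio p q x = logDensity Θ V p x - logDensity Θ V' q x
      + (Real.log (gibbs Θ V x) - Real.log (gibbs Θ V' x)) := by
  simp only [logRatio, logDensity]
  ring

include hs hs'

lemma kl_eq {t : ℝ} (ht : t ∈ Icc 0 T) :
    kl Θ (ρ t) (ρ' t) = ∫ x in Θ, logRatio (ρ t) (ρ' t) x * ρ t x := by
  simp only [kl, logRatio, Real.log_div (hs.ne_zero ht _) (hs'.ne_zero ht _)]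

lemma contDiff_logRatio {t : ℝ} (ht : t ∈ Icc 0 T) : ContDiff ℝ 2 (logRatio (ρ t) (ρ' t)) :=
  ((hs.isC12.contDiff_space t ht).log (hs.ne_zero ht)).sub
    ((hs'.isC12.contDiff_space t ht).log (hs'.ne_zero ht))

lemma isInvariant_logRatio {t : ℝ} (ht : t ∈ Icc 0 T) : IsInvariant Γ (logRatio (ρ t) (ρ' t)) :=
  fun γ hγ x => by simp only [logRatio, hs.isInvariant t ht γ hγ, hs'.isInvariant t ht γ hγ]

lemma exp_logRatio_mul {t : ℝ} (ht : t ∈ Icc 0 T) (x : E d) :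
    Real.exp (logRatio (ρ t) (ρ' t) x) * ρ' t x = ρ t x := by
  rw [logRatio, Real.exp_sub, Real.exp_log (hs.pos t ht x), Real.exp_log (hs'.pos t ht x),
    div_mul_cancel₀ _ (hs'.ne_zero ht x)]

include hΘ

lemma hasDerivWithinAt_kl {t : ℝ} (ht : t ∈ Icc 0 T) :
    HasDerivWithinAt (fun t => kl Θ (ρ t) (ρ' t))
      ((∫ x in Θ, logRatio (ρ t) (ρ' t) x * timeDeriv T ρ t x) + (∫ x in Θ, timeDeriv T ρ t x)
        - ∫ x in Θ, Real.exp (logRatio (ρ t) (ρ' t) x) * timeDeriv T ρ' t x) (Icc 0 T) t := by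
  have hg : ContinuousOn (fun p : ℝ × E d => logRatio (ρ p.1) (ρ' p.1) p.2) (Icc 0 T ×ˢ univ) :=
    hs.continuousOn_log.sub hs'.continuousOn_log
  have hτ := hs.isC12.continuousOn_timeDeriv
  have hτ' := hs'.isC12.continuousOn_timeDeriv
  have hd := hΘ.hasDerivWithinAt_setIntegral (T := T)
    (f := fun t x => logRatio (ρ t) (ρ' t) x * ρ t x)
    (f' := fun t x => logRatio (ρ t) (ρ' t) x * timeDeriv T ρ t x
      + timeDeriv T ρ t x - Real.exp (logRatio (ρ t) (ρ' t) x) * timeDeriv T ρ' t x)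
    (fun s hs₀ => (contDiff_logRatio hs hs' hs₀).continuous.mul (hs.continuous_slice hs₀))
    (fun s hs₀ x => by
      have h1 := hs.hasDerivWithinAt hs₀ x
      have h2 := hs'.hasDerivWithinAt hs₀ x
      have h3 := ((h1.log (hs.ne_zero hs₀ x)).sub (h2.log (hs'.ne_zero hs₀ x))).mul h1
      refine h3.congr_deriv ?_
      have n1 := hs.ne_zero hs₀ x
      have n2 := hs'.ne_zero hs₀ x
      have e := eq_div_of_mul_eq n2 (exp_logRatio_mul hs hs' hs₀ x)
      rw [e]
      change (_ - _) * _ + logRatio (ρ s) (ρ' s) x * _ = _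
      field_simp
      ring)
    ((hg.mul hτ).add hτ |>.sub ((Real.continuous_exp.comp_continuousOn hg).mul hτ')) ht
  have hslice : ∀ {u : ℝ → E d → ℝ},
      ContinuousOn (fun p : ℝ × E d => u p.1 p.2) (Icc 0 T ×ˢ univ) → Continuous (u t) :=
    fun {u} hu => by
      have := hu.comp_continuous (f := fun x : E d => (t, x)) (by fun_prop)
        fun x => ⟨ht, mem_univ _⟩
      exact this
  have c1 := (contDiff_logRatio hs hs' ht).continuous
  have c2 := hslice hτ
  have c3 := hslice hτ'
  rw [integral_sub (hΘ.integrableOn (by fun_prop)) (hΘ.integrableOn (by fun_prop)),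
    integral_add (hΘ.integrableOn (by fun_prop)) (hΘ.integrableOn (by fun_prop))] at hd
  exact hd.congr (fun s hs₀ => kl_eq hs hs' hs₀) (kl_eq hs hs' ht)

variable (hV : ContDiff ℝ 2 V) (hV' : ContDiff ℝ 2 V') (hVΓ : IsInvariant Γ V)
  (hVΓ' : IsInvariant Γ V')
include hV hV'

lemma gradient_logDensity_sub {t : ℝ} (ht : t ∈ Icc 0 T) (x : E d) :
    gradient (logDensity Θ V (ρ t)) x - gradient (logDensity Θ V' (ρ' t)) x
      = gradient (logRatio (ρ t) (ρ' t)) x + (gradient V x - gradient V' x) := by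
  have hw := (hs.contDiff_logDensity hΘ hV ht).differentiable two_ne_zero x
  have hw' := (hs'.contDiff_logDensity hΘ hV' ht).differentiable two_ne_zero x
  have hg := (contDiff_logRatio hs hs' ht).differentiable two_ne_zero x
  have h1 := hw.hasFDerivAt.sub hw'.hasFDerivAt
  have h2 := ((hg.hasFDerivAt.add ((hV.differentiable two_ne_zero x).hasFDerivAt.sub
    (hV'.differentiable two_ne_zero x).hasFDerivAt)).add_const
    (Real.log (∫ y in Θ, Real.exp (-V y)) - Real.log (∫ y in Θ, Real.exp (-V' y))))
  have he : ∀ y, logDensity Θ V (ρ t) y - logDensity Θ V' (ρ' t) y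
      = logRatio (ρ t) (ρ' t) y + (V y - V' y)
        + (Real.log (∫ y in Θ, Real.exp (-V y)) - Real.log (∫ y in Θ, Real.exp (-V' y))) :=
    fun y => by
      rw [logDensity_eq hΘ hV, logDensity_eq hΘ hV', logRatio]
      ring
  have h3 := h1.unique (h2.congr_of_eventuallyEq (Eventually.of_forall he))
  simp only [gradient, ← map_sub, ← map_add, h3]

include hVΓ

/-- The transport part is bounded by Young's inequality. -/
lemma transport_le {t : ℝ} (ht : t ∈ Icc 0 T) {Δ c : ℝ} (hc : 0 < c)
    (hΔ : ∀ x, ‖gradient V x - gradient V' x‖ ≤ Δ) :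
    -(∫ x in Θ, ⟪gradient (logRatio (ρ t) (ρ' t)) x,
        gradient (logRatio (ρ t) (ρ' t)) x + (gradient V x - gradient V' x)⟫ * ρ t x)
      ≤ -((1 - c) * ∫ x in Θ, ‖gradient (logRatio (ρ t) (ρ' t)) x‖ ^ 2 * ρ t x)
        + 1 / (4 * c) * Δ ^ 2 := by
  set g := logRatio (ρ t) (ρ' t)
  have hcρ := hs.continuous_slice ht
  have hcg : Continuous (gradient g) :=
    (contDiff_gradient (m := 1) (contDiff_logRatio hs hs' ht) (by norm_num)).continuous
  have hcV : Continuous (gradient V) := (contDiff_gradient (m := 1) hV (by norm_num)).continuous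
  have hcV' : Continuous (gradient V') := (contDiff_gradient (m := 1) hV' (by norm_num)).continuous
  have h1 : ∀ x, -⟪gradient g x, gradient g x + (gradient V x - gradient V' x)⟫
      ≤ -(1 - c) * ‖gradient g x‖ ^ 2 + 1 / (4 * c) * Δ ^ 2 := fun x => by
    rw [inner_add_right, real_inner_self_eq_norm_sq]
    have h2 := (neg_le_abs _).trans
      (abs_real_inner_le_norm (gradient g x) (gradient V x - gradient V' x))
    have h3 := mul_le_mul_of_nonneg_left (hΔ x) (norm_nonneg (gradient g x))
    have h4 : ‖gradient g x‖ * Δ ≤ c * ‖gradient g x‖ ^ 2 + 1 / (4 * c) * Δ ^ 2 := by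
      have h5 : c * ‖gradient g x‖ ^ 2 + 1 / (4 * c) * Δ ^ 2 - ‖gradient g x‖ * Δ
          = c * (‖gradient g x‖ - Δ / (2 * c)) ^ 2 := by field_simp; ring
      have := mul_nonneg hc.le (sq_nonneg (‖gradient g x‖ - Δ / (2 * c)))
      linarith
    linarith
  calc _ ≤ ∫ x in Θ, (-(1 - c) * (‖gradient g x‖ ^ 2 * ρ t x) + 1 / (4 * c) * Δ ^ 2 * ρ t x) := by
        rw [← integral_neg]
        refine integral_mono (hΘ.integrableOn (by fun_prop)) (hΘ.integrableOn (by fun_prop))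
          fun x => ?_
        have := mul_le_mul_of_nonneg_right (h1 x) (hs.pos t ht x).le
        simp only
        linarith
    _ = _ := by
        rw [integral_add (hΘ.integrableOn (by fun_prop)) (hΘ.integrableOn (by fun_prop)),
          integral_const_mul, integral_const_mul, hs.mass_eq_one hΘ hV hVΓ ht]
        ring

include hVΓ'

/-- The derivative of the relative entropy: a transport part and a birth-death part. -/
lemma kl_deriv_eq {t : ℝ} (ht : t ∈ Icc 0 T) :
    (∫ x in Θ, logRatio (ρ t) (ρ' t) x * timeDeriv T ρ t x) + (∫ x in Θ, timeDeriv T ρ t x)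
        - ∫ x in Θ, Real.exp (logRatio (ρ t) (ρ' t) x) * timeDeriv T ρ' t x
      = -(∫ x in Θ, ⟪gradient (logRatio (ρ t) (ρ' t)) x,
            gradient (logRatio (ρ t) (ρ' t)) x + (gradient V x - gradient V' x)⟫ * ρ t x)
        - (∫ x in Θ, logRatio (ρ t) (ρ' t) x * (rate Θ V (ρ t) x * ρ t x))
        + ∫ x in Θ, rate Θ V' (ρ' t) x * ρ t x := by
  set g := logRatio (ρ t) (ρ' t) with hgdef
  have hg : ContDiff ℝ 2 g := contDiff_logRatio hs hs' ht
  have hgΓ : IsInvariant Γ g := isInvariant_logRatio hs hs' ht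
  have e1 := hs.setIntegral_mul_timeDeriv hΘ hV hVΓ ht (hg.of_le one_le_two) hgΓ
  -- the test function `e ^ g = ρ / ρ'`, whose gradient turns the weight `ρ'` into `ρ`
  have e2 := hs'.setIntegral_mul_timeDeriv hΘ hV' hVΓ' ht (φ := fun x => Real.exp (g x))
    (hg.of_le one_le_two).exp (fun γ hγ x => by simp only [hgΓ γ hγ])
  have e3 := hs.setIntegral_timeDeriv hΘ hV hVΓ ht
  rw [hs.mass_eq_one hΘ hV hVΓ ht, sub_self, mul_zero] at e3
  have hgrad : ∀ x, gradient (fun x => Real.exp (g x)) x = Real.exp (g x) • gradient g x :=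
    fun x => by
    refine HasGradientAt.gradient ?_
    rw [hasGradientAt_iff_hasFDerivAt, map_smul, toDual_gradient]
    exact (hg.differentiable two_ne_zero x).hasFDerivAt.exp
  have r1 : ∀ x, ⟪gradient (fun x => Real.exp (g x)) x, gradient (logDensity Θ V' (ρ' t)) x⟫
      * ρ' t x = ⟪gradient g x, gradient (logDensity Θ V' (ρ' t)) x⟫ * ρ t x := fun x => by
    rw [hgrad, real_inner_smul_left, ← exp_logRatio_mul hs hs' ht x]
    ring
  have r2 : ∀ x, Real.exp (g x) * (rate Θ V' (ρ' t) x * ρ' t x)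
      = rate Θ V' (ρ' t) x * ρ t x := fun x => by
    rw [← exp_logRatio_mul hs hs' ht x]
    ring
  simp only [r1, r2] at e2
  have hcρ := hs.continuous_slice ht
  have hcg : Continuous (gradient g) := (contDiff_gradient (m := 1) hg (by norm_num)).continuous
  have hcw : Continuous (gradient (logDensity Θ V (ρ t))) :=
    (contDiff_gradient (m := 1) (hs.contDiff_logDensity hΘ hV ht) (by norm_num)).continuous
  have hcw' : Continuous (gradient (logDensity Θ V' (ρ' t))) :=
    (contDiff_gradient (m := 1) (hs'.contDiff_logDensity hΘ hV' ht) (by norm_num)).continuous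
  have e4 : ∫ x in Θ, ⟪gradient g x, gradient g x + (gradient V x - gradient V' x)⟫ * ρ t x
      = (∫ x in Θ, ⟪gradient g x, gradient (logDensity Θ V (ρ t)) x⟫ * ρ t x)
        - ∫ x in Θ, ⟪gradient g x, gradient (logDensity Θ V' (ρ' t)) x⟫ * ρ t x := by
    rw [← integral_sub (hΘ.integrableOn (by fun_prop)) (hΘ.integrableOn (by fun_prop))]
    refine integral_congr_ae (Eventually.of_forall fun x => ?_)
    simp only [hgdef, ← gradient_logDensity_sub hΘ hs hs' hV hV' ht x, inner_sub_right]
    ring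
  rw [e1, e2, e3, e4]
  ring

/-- The Fisher information controls the relative entropy: along the flow `ρ'` stays within the
oscillation of `log (ρ' / π')` of the Gibbs density `π'`, whose log-Sobolev inequality it
inherits. -/
lemma kl_le_fisher {t : ℝ} (ht : t ∈ Icc 0 T) {lam a : ℝ} (hlam : 0 < lam)
    (hLSI : LogSobolev Γ Θ (gibbs Θ V') lam)
    (ha : ∀ x y, logDensity Θ V' (ρ' t) x - logDensity Θ V' (ρ' t) y ≤ a) :
    2 * Real.exp (-a) * lam * kl Θ (ρ t) (ρ' t)
      ≤ ∫ x in Θ, ‖gradient (logRatio (ρ t) (ρ' t)) x‖ ^ 2 * ρ t x := by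
  obtain ⟨k, hk⟩ := hΘ.exists_abs_sub_le (hs'.contDiff_logDensity hΘ hV' ht).continuous
    (hVΓ'.logDensity (hs'.isInvariant t ht)) ha
  have hρ' : ∀ x, ρ' t x = Real.exp (logDensity Θ V' (ρ' t) x) * gibbs Θ V' x := fun x => by
    have hg := hΘ.gibbs_pos hV'.continuous x
    rw [logDensity, Real.exp_sub, Real.exp_log (hs'.pos t ht x), Real.exp_log hg,
      div_mul_cancel₀ _ hg.ne']
  have h := hLSI.relativeEntropy_le hΘ hlam (q := ρ' t) (Real.exp_pos (k - a / 2))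
    (Real.exp_pos (k + a / 2)).le (continuous_gibbs hV'.continuous) (hs'.continuous_slice ht)
    (hΘ.gibbs_pos hV'.continuous) (hΘ.setIntegral_gibbs hV'.continuous)
    (fun x => by
      rw [hρ' x]
      refine mul_le_mul_of_nonneg_right (Real.exp_le_exp.2 ?_) (hΘ.gibbs_pos hV'.continuous x).le
      linarith [(abs_le.1 (hk x)).1])
    (fun x => by
      rw [hρ' x]
      refine mul_le_mul_of_nonneg_right (Real.exp_le_exp.2 ?_) (hΘ.gibbs_pos hV'.continuous x).le
      linarith [(abs_le.1 (hk x)).2])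
    ((contDiff_logRatio hs hs' ht).of_le one_le_two) (isInvariant_logRatio hs hs' ht)
    (hs'.mass_eq_one hΘ hV' hVΓ' ht)
    (by simp only [exp_logRatio_mul hs hs' ht, hs.mass_eq_one hΘ hV hVΓ ht])
  simp only [exp_logRatio_mul hs hs' ht] at h
  rw [← kl_eq hs hs' ht, ← Real.exp_sub] at h
  have he : Real.exp (-a) * Real.exp (k + a / 2 - (k - a / 2)) = 1 := by
    rw [← Real.exp_add]
    ring_nf
    exact Real.exp_zero
  set I := ∫ x in Θ, ‖gradient (logRatio (ρ t) (ρ' t)) x‖ ^ 2 * ρ t x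
  calc 2 * Real.exp (-a) * lam * kl Θ (ρ t) (ρ' t)
      ≤ 2 * Real.exp (-a) * lam * (Real.exp (k + a / 2 - (k - a / 2)) / (2 * lam) * I) := by gcongr
    _ = Real.exp (-a) * Real.exp (k + a / 2 - (k - a / 2)) * I := by field_simp
    _ = I := by rw [he, one_mul]

/-- The birth-death part, in terms of the oscillations of the two log-densities. -/
lemma birthDeath_le {t : ℝ} (ht : t ∈ Icc 0 T) {a a' S : ℝ}
    (ha : ∀ x y, logDensity Θ V (ρ t) x - logDensity Θ V (ρ t) y ≤ a)
    (ha' : ∀ x y, logDensity Θ V' (ρ' t) x - logDensity Θ V' (ρ' t) y ≤ a')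
    (hS : ∀ x, |Real.log (gibbs Θ V x / gibbs Θ V' x)| ≤ S) :
    -(∫ x in Θ, logRatio (ρ t) (ρ' t) x * (rate Θ V (ρ t) x * ρ t x))
        + (∫ x in Θ, rate Θ V' (ρ' t) x * ρ t x)
      ≤ a' ^ 2 / 16 + S * (a / 2) + a' := by
  have hcw := (hs.contDiff_logDensity hΘ hV ht).continuous
  have hcw' := (hs'.contDiff_logDensity hΘ hV' ht).continuous
  have hcρ := hs.continuous_slice ht
  have hcρ' := hs'.continuous_slice ht
  have hwΓ := hVΓ.logDensity (Θ := Θ) (hs.isInvariant t ht)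
  have hwΓ' := hVΓ'.logDensity (Θ := Θ) (hs'.isInvariant t ht)
  have hpos := fun x => (hs.pos t ht x).le
  have hpos' := fun x => (hs'.pos t ht x).le
  have hm := hs.mass_eq_one hΘ hV hVΓ ht
  have hm' := hs'.mass_eq_one hΘ hV' hVΓ' ht
  have hcσ : Continuous fun x => Real.log (gibbs Θ V x) - Real.log (gibbs Θ V' x) :=
    ((continuous_gibbs hV.continuous).log fun x => (hΘ.gibbs_pos hV.continuous x).ne').sub
      ((continuous_gibbs hV'.continuous).log fun x => (hΘ.gibbs_pos hV'.continuous x).ne')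
  have h1 := hΘ.neg_covariance_le hcρ hpos hm hcw hwΓ hcw' hwΓ' hcσ ha ha' (S := S) fun x => by
    rw [← Real.log_div (hΘ.gibbs_pos hV.continuous x).ne' (hΘ.gibbs_pos hV'.continuous x).ne']
    exact hS x
  -- `log (ρ / ρ') = w - w' + log (π / π')`
  have e1 : ∫ x in Θ, logRatio (ρ t) (ρ' t) x * (rate Θ V (ρ t) x * ρ t x)
      = ∫ x in Θ, (logDensity Θ V (ρ t) x - logDensity Θ V' (ρ' t) x
          + (Real.log (gibbs Θ V x) - Real.log (gibbs Θ V' x)))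
        * ((logDensity Θ V (ρ t) x - ∫ y in Θ, logDensity Θ V (ρ t) y * ρ t y) * ρ t x) :=
    integral_congr_ae (Eventually.of_forall fun x => by
      simp only [logRatio_eq (Θ := Θ) V V', rate_eq])
  obtain ⟨k, hk⟩ := hΘ.exists_abs_sub_le hcw' hwΓ' ha'
  have h2 : ∫ x in Θ, rate Θ V' (ρ' t) x * ρ t x ≤ a' := by
    refine hΘ.setIntegral_mul_le hcρ hpos hm (u := rate Θ V' (ρ' t))
      (hcw'.sub continuous_const) fun x => ?_
    have h3 := hΘ.setIntegral_mul_le hcρ' hpos' hm' (u := fun y => -logDensity Θ V' (ρ' t) y)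
      (C := -(k - a' / 2)) hcw'.neg fun y => by linarith [(abs_le.1 (hk y)).1]
    simp only [neg_mul, integral_neg] at h3
    rw [rate_eq]
    linarith [(abs_le.1 (hk x)).2]
  rw [e1]
  linarith

end TwoSolutions

/-! ### Comparison of the Gibbs densities -/

lemma abs_log_gibbs_div_le (hΘ : IsClosedFlatDomain Γ Θ) {V V' : E d → ℝ} (hV : Continuous V)
    (hV' : Continuous V') {m M : ℝ} (hm : ∀ x, m ≤ V x - V' x) (hM : ∀ x, V x - V' x ≤ M)
    (x : E d) : |Real.log (gibbs Θ V x / gibbs Θ V' x)| ≤ M - m := by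
  have hZ := hΘ.partition_pos hV
  have hZ' := hΘ.partition_pos hV'
  have h1 : Real.exp m * ∫ y in Θ, Real.exp (-V y) ≤ ∫ y in Θ, Real.exp (-V' y) := by
    rw [← integral_const_mul]
    refine integral_mono (hΘ.integrableOn (by fun_prop)) (hΘ.integrableOn (by fun_prop))
      fun y => ?_
    simp only [← Real.exp_add]
    exact Real.exp_le_exp.2 (by linarith [hm y])
  have h2 : ∫ y in Θ, Real.exp (-V' y) ≤ Real.exp M * ∫ y in Θ, Real.exp (-V y) := by
    rw [← integral_const_mul]
    refine integral_mono (hΘ.integrableOn (by fun_prop)) (hΘ.integrableOn (by fun_prop))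
      fun y => ?_
    simp only [← Real.exp_add]
    exact Real.exp_le_exp.2 (by linarith [hM y])
  have l1 := Real.log_le_log (mul_pos (Real.exp_pos m) hZ) h1
  have l2 := Real.log_le_log hZ' h2
  rw [Real.log_mul (Real.exp_pos _).ne' hZ.ne', Real.log_exp] at l1 l2
  rw [Real.log_div (hΘ.gibbs_pos hV x).ne' (hΘ.gibbs_pos hV' x).ne', hΘ.log_gibbs hV,
    hΘ.log_gibbs hV', abs_le]
  constructor <;> linarith [hm x, hM x]

/-! ### Integration of the differential inequality -/

/-- Grönwall's inequality with variable coefficients, by the integrating factor. -/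
lemma le_integral_of_derivWithin_le {H a b : ℝ → ℝ} (ha : Continuous a) (hb : Continuous b)
    (hd : DifferentiableOn ℝ H (Icc 0 T))
    (h : ∀ t ∈ Icc 0 T, derivWithin H (Icc 0 T) t ≤ -a t * H t + b t) (h0 : H 0 ≤ 0)
    {t : ℝ} (ht : t ∈ Icc 0 T) :
    H t ≤ ∫ s in (0 : ℝ)..t, Real.exp (-∫ u in s..t, a u) * b s := by
  set A : ℝ → ℝ := fun t => ∫ u in (0 : ℝ)..t, a u with hA
  have hAd : ∀ s, HasDerivAt A (a s) s := fun s => ha.integral_hasStrictDerivAt 0 s |>.hasDerivAt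
  have hAc : Continuous A := continuous_iff_continuousAt.2 fun s => (hAd s).continuousAt
  have hbc : Continuous fun s => Real.exp (A s) * b s := by fun_prop
  have hG : ∀ s ∈ Icc 0 T, HasDerivWithinAt
      (fun t => Real.exp (A t) * H t - ∫ s in (0 : ℝ)..t, Real.exp (A s) * b s)
      ((Real.exp (A s) * a s) * H s + Real.exp (A s) * derivWithin H (Icc 0 T) s
        - Real.exp (A s) * b s) (Icc 0 T) s := fun s hs =>
    (((hAd s).exp.hasDerivWithinAt).mul (hd s hs).hasDerivWithinAt).sub
      (hbc.integral_hasStrictDerivAt 0 s).hasDerivAt.hasDerivWithinAt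
  have hanti := antitoneOn_of_hasDerivWithinAt_nonpos (convex_Icc 0 T)
    (fun s hs => (hG s hs).continuousWithinAt)
    (fun s hs => (hG s (interior_subset hs)).mono interior_subset)
    (fun s hs => by
      have := mul_le_mul_of_nonneg_left (h s (interior_subset hs)) (Real.exp_pos (A s)).le
      linarith)
  have hle := hanti (left_mem_Icc.2 (ht.1.trans ht.2)) ht ht.1
  simp only [hA, intervalIntegral.integral_same, Real.exp_zero, one_mul, sub_zero] at hle
  have hle' : Real.exp (A t) * H t ≤ ∫ s in (0 : ℝ)..t, Real.exp (A s) * b s := by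
    linarith
  have he : ∀ s, Real.exp (-∫ u in s..t, a u) * b s = Real.exp (-A t) * (Real.exp (A s) * b s) :=
    fun s => by
      rw [← intervalIntegral.integral_interval_sub_left (ha.intervalIntegrable 0 t)
        (ha.intervalIntegrable 0 s), ← mul_assoc, ← Real.exp_add]
      congr 2
      ring
  simp only [he, intervalIntegral.integral_const_mul]
  rw [Real.exp_neg, le_inv_mul_iff₀ (Real.exp_pos _)]
  exact hle'

lemma integral_exp_mul_exp {κ m : ℝ} (h : κ ≠ m) (t : ℝ) :
    ∫ s in (0 : ℝ)..t, Real.exp (-κ * (t - s)) * Real.exp (-m * s)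
      = (Real.exp (-m * t) - Real.exp (-κ * t)) / (κ - m) := by
  have hκ : κ - m ≠ 0 := sub_ne_zero.2 h
  have hd : ∀ s, HasDerivAt (fun s => Real.exp (-κ * (t - s) + -m * s) / (κ - m))
      (Real.exp (-κ * (t - s)) * Real.exp (-m * s)) s := fun s => by
    have h1 : HasDerivAt (fun s => -κ * (t - s) + -m * s) (-κ * (-1) + -m * 1) s :=
      (((hasDerivAt_id s).const_sub t).const_mul (-κ)).add ((hasDerivAt_id s).const_mul (-m))
    refine (h1.exp.div_const (κ - m)).congr_deriv ?_
    rw [← Real.exp_add]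
    field_simp
    ring
  rw [intervalIntegral.integral_eq_sub_of_hasDerivAt (fun s _ => hd s)
    (Continuous.intervalIntegrable (by fun_prop) _ _), ← sub_div]
  simp

lemma integral_exp_mul_exp_self (m t : ℝ) :
    ∫ s in (0 : ℝ)..t, Real.exp (-m * (t - s)) * Real.exp (-m * s) = t * Real.exp (-m * t) := by
  have : ∀ s, Real.exp (-m * (t - s)) * Real.exp (-m * s) = Real.exp (-m * t) := fun s => by
    rw [← Real.exp_add]
    congr 1
    ring
  simp only [this]
  rw [intervalIntegral.integral_const, sub_zero, smul_eq_mul]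

/-- The integrated bound with the decay rate replaced by its smallest value `κ` and the
oscillations replaced by `B`. -/
lemma integral_forcing_le {Δ S R R' B c lam κ t : ℝ} (hB : 0 ≤ B) (hR : R ≤ B) (hR'0 : 0 ≤ R')
    (hR' : R' ≤ B) (hS : 0 ≤ S) (hR0 : 0 ≤ R) (hc0 : 0 < c) (hc : c < 1) (hlam : 0 < lam)
    (hκ : κ = 2 * (1 - c) * Real.exp (-B) * lam) (ht : 0 ≤ t) :
    ∫ s in (0 : ℝ)..t,
        Real.exp (-2 * (1 - c) * lam * ∫ u in s..t, Real.exp (-(Real.exp (-u) * B)))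
          * forcing Δ S R R' c s
      ≤ Δ ^ 2 / (4 * c) * (∫ s in (0 : ℝ)..t, Real.exp (-κ * (t - s)) * Real.exp (-0 * s))
        + B * (S / 2 + 2) * (∫ s in (0 : ℝ)..t, Real.exp (-κ * (t - s)) * Real.exp (-1 * s))
        + B ^ 2 / 16 * ∫ s in (0 : ℝ)..t, Real.exp (-κ * (t - s)) * Real.exp (-2 * s) := by
  have hcr : Continuous fun u => Real.exp (-(Real.exp (-u) * B)) := by fun_prop
  have hcI : Continuous fun s => ∫ u in s..t, Real.exp (-(Real.exp (-u) * B)) := by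
    simp only [fun s => intervalIntegral.integral_symm (f := fun u =>
      Real.exp (-(Real.exp (-u) * B))) (μ := volume) t s]
    exact (intervalIntegral.continuous_primitive (fun a b => hcr.intervalIntegrable a b) t).neg
  have hcf : Continuous fun s => forcing Δ S R R' c s := by
    unfold forcing
    fun_prop
  rw [← intervalIntegral.integral_const_mul (Δ ^ 2 / (4 * c)),
    ← intervalIntegral.integral_const_mul (B * (S / 2 + 2)),
    ← intervalIntegral.integral_const_mul (B ^ 2 / 16),
    ← intervalIntegral.integral_add (Continuous.intervalIntegrable (by fun_prop) _ _)
    (Continuous.intervalIntegrable (by fun_prop) _ _), ← intervalIntegral.integral_add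
    (Continuous.intervalIntegrable (by fun_prop) _ _)
    (Continuous.intervalIntegrable (by fun_prop) _ _)]
  refine intervalIntegral.integral_mono_on ht (Continuous.intervalIntegrable (by fun_prop) _ _)
    (Continuous.intervalIntegrable (by fun_prop) _ _) fun s hs => ?_
  have h1 : (t - s) * Real.exp (-B) ≤ ∫ u in s..t, Real.exp (-(Real.exp (-u) * B)) := by
    rw [← smul_eq_mul, ← intervalIntegral.integral_const]
    refine intervalIntegral.integral_mono_on hs.2 (continuous_const.intervalIntegrable _ _)
      (hcr.intervalIntegrable _ _) fun u hu => Real.exp_le_exp.2 (neg_le_neg ?_)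
    have : Real.exp (-u) ≤ 1 := Real.exp_le_one_iff.2 (by linarith [hs.1, hu.1])
    exact mul_le_of_le_one_left hB this
  have h2 : Real.exp (-2 * (1 - c) * lam * ∫ u in s..t, Real.exp (-(Real.exp (-u) * B)))
      ≤ Real.exp (-κ * (t - s)) := by
    refine Real.exp_le_exp.2 ?_
    have : 0 ≤ 2 * (1 - c) * lam := by have := sub_pos.2 hc; positivity
    have := mul_le_mul_of_nonneg_left h1 this
    rw [hκ]
    linarith
  have h3 : 0 ≤ forcing Δ S R R' c s := by
    unfold forcing
    positivity
  have h4 : forcing Δ S R R' c s ≤ Δ ^ 2 / (4 * c) + B * (S / 2 + 2) * Real.exp (-1 * s)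
      + B ^ 2 / 16 * Real.exp (-2 * s) := by
    have e1 := Real.exp_pos (-s)
    have e2 := Real.exp_pos (-2 * s)
    have i1 : R' ^ 2 / 16 * Real.exp (-2 * s) ≤ B ^ 2 / 16 * Real.exp (-2 * s) := by gcongr
    have i2 : 1 / 2 * S * R * Real.exp (-s) ≤ 1 / 2 * S * B * Real.exp (-s) := by gcongr
    have i3 : 2 * R' * Real.exp (-s) ≤ 2 * B * Real.exp (-s) := by gcongr
    have i4 : 1 / (4 * c) * Δ ^ 2 = Δ ^ 2 / (4 * c) := by ring
    rw [forcing, i4, neg_one_mul]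
    linarith
  calc _ ≤ Real.exp (-κ * (t - s)) * (Δ ^ 2 / (4 * c) + B * (S / 2 + 2) * Real.exp (-1 * s)
      + B ^ 2 / 16 * Real.exp (-2 * s)) := mul_le_mul h2 h4 h3 (Real.exp_pos _).le
    _ = _ := by
      simp only [neg_zero, zero_mul, Real.exp_zero]
      ring

end SHK

end

theorem theorem2 {d : ℕ} (Γ : Subgroup (SHK.E d ≃ᵢ SHK.E d)) (Θ : Set (SHK.E d))
    (hΘ : SHK.IsClosedFlatDomain Γ Θ)
    (V V' : SHK.E d → ℝ)
    (hV : ContDiff ℝ 2 V) (hV' : ContDiff ℝ 2 V')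
    (hVinv : SHK.IsInvariant Γ V) (hVinv' : SHK.IsInvariant Γ V')
    (T : ℝ) (hT : 0 < T) (ρ ρ' : ℝ → SHK.E d → ℝ)
    (hρ : SHK.IsPositiveSolution Γ Θ V T ρ) (hρ' : SHK.IsPositiveSolution Γ Θ V' T ρ')
    (hinit : ρ 0 = ρ' 0)
    (Δgrad : ℝ) (hgrad : ∀ x, ‖gradient V x - gradient V' x‖ ≤ Δgrad)
    (lam : ℝ) (hlam : 0 < lam)
    (hLSI : SHK.LogSobolev Γ Θ (SHK.gibbs Θ V) lam)
    (hLSI' : SHK.LogSobolev Γ Θ (SHK.gibbs Θ V') lam)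
    (R₀ R₀' : ℝ)
    (hR₀ : R₀ = SHK.osc (fun x => Real.log (ρ 0 x / SHK.gibbs Θ V x)))
    (hR₀' : R₀' = SHK.osc (fun x => Real.log (ρ' 0 x / SHK.gibbs Θ V' x)))
    (B : ℝ) (hB : 0 ≤ B) (hRB : R₀ ≤ B) (hRB' : R₀' ≤ B)
    (S : ℝ) (hS : ∀ x, |Real.log (SHK.gibbs Θ V x / SHK.gibbs Θ V' x)| ≤ S)
    (H : ℝ → ℝ) (hH : ∀ t, H t = SHK.kl Θ (ρ t) (ρ' t)) :
    -- the differential inequality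
    (DifferentiableOn ℝ H (Set.Icc 0 T) ∧
      ∀ c : ℝ, 0 < c → c < 1 → ∀ t ∈ Set.Icc 0 T,
        derivWithin H (Set.Icc 0 T) t
          ≤ -2 * (1 - c) * Real.exp (-(Real.exp (-t) * B)) * lam * H t
            + SHK.forcing Δgrad S R₀ R₀' c t) ∧
    -- the integrated bound
    (∀ c : ℝ, 0 < c → c < 1 → ∀ t ∈ Set.Icc 0 T,
      H t ≤ ∫ s in (0 : ℝ)..t,
        Real.exp (-2 * (1 - c) * lam * ∫ u in s..t, Real.exp (-(Real.exp (-u) * B)))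
          * SHK.forcing Δgrad S R₀ R₀' c s) ∧
    -- the explicit bounds
    (∀ c : ℝ, 0 < c → c < 1 → ∀ A₁ A₂ A₃ κ : ℝ,
      A₁ = Δgrad ^ 2 / (4 * c) → A₂ = B * (S / 2 + 2) → A₃ = B ^ 2 / 16 →
      κ = 2 * (1 - c) * Real.exp (-B) * lam →
      ∀ t ∈ Set.Icc 0 T,
        (κ ≠ 1 → κ ≠ 2 →
          H t ≤ A₁ * ((1 - Real.exp (-κ * t)) / κ)
            + A₂ * ((Real.exp (-t) - Real.exp (-κ * t)) / (κ - 1))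
            + A₃ * ((Real.exp (-2 * t) - Real.exp (-κ * t)) / (κ - 2))) ∧
        (κ = 1 →
          H t ≤ A₁ * ((1 - Real.exp (-κ * t)) / κ)
            + A₂ * (t * Real.exp (-t))
            + A₃ * ((Real.exp (-2 * t) - Real.exp (-κ * t)) / (κ - 2))) ∧
        (κ = 2 →
          H t ≤ A₁ * ((1 - Real.exp (-κ * t)) / κ)
            + A₂ * ((Real.exp (-t) - Real.exp (-κ * t)) / (κ - 1))
            + A₃ * (t * Real.exp (-2 * t)))) ∧
    -- admissible choices of the constant `S`
    (∀ Δpot : ℝ, (∀ x, |V x - V' x| ≤ Δpot) →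
      ∀ x, |Real.log (SHK.gibbs Θ V x / SHK.gibbs Θ V' x)| ≤ 2 * Δpot) ∧
    (∀ Δosc : ℝ, SHK.osc (fun x => V x - V' x) ≤ Δosc →
      ∀ x, |Real.log (SHK.gibbs Θ V x / SHK.gibbs Θ V' x)| ≤ Δosc) := by
  have h0 : (0 : ℝ) ∈ Set.Icc 0 T := ⟨le_rfl, hT.le⟩
  have hw₀ : R₀ = SHK.osc (SHK.logDensity Θ V (ρ 0)) := by
    rw [hR₀]
    congr 1
    funext x
    rw [SHK.logDensity, Real.log_div (hρ.ne_zero h0 x) (hΘ.gibbs_pos hV.continuous x).ne']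
  have hw₀' : R₀' = SHK.osc (SHK.logDensity Θ V' (ρ' 0)) := by
    rw [hR₀']
    congr 1
    funext x
    rw [SHK.logDensity, Real.log_div (hρ'.ne_zero h0 x) (hΘ.gibbs_pos hV'.continuous x).ne']
  have hdecay : ∀ t ∈ Set.Icc 0 T, ∀ x y, SHK.logDensity Θ V (ρ t) x - SHK.logDensity Θ V (ρ t) y
      ≤ Real.exp (-t) * R₀ := fun t ht x y => by
    rw [hw₀]
    exact hρ.logDensity_sub_le hΘ hV hVinv ht x y
  have hdecay' : ∀ t ∈ Set.Icc 0 T, ∀ x y,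
      SHK.logDensity Θ V' (ρ' t) x - SHK.logDensity Θ V' (ρ' t) y
      ≤ Real.exp (-t) * R₀' := fun t ht x y => by
    rw [hw₀']
    exact hρ'.logDensity_sub_le hΘ hV' hVinv' ht x y
  have hR₀0 : 0 ≤ R₀ := by simpa using hdecay 0 h0 0 0
  have hR₀0' : 0 ≤ R₀' := by simpa using hdecay' 0 h0 0 0
  have hS0 : 0 ≤ S := (abs_nonneg _).trans (hS 0)
  have hHeq : H = fun t => SHK.kl Θ (ρ t) (ρ' t) := funext hH
  have hderiv := fun t (ht : t ∈ Set.Icc 0 T) => SHK.hasDerivWithinAt_kl hΘ hρ hρ' ht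
  rw [← hHeq] at hderiv
  have hdiff : DifferentiableOn ℝ H (Set.Icc 0 T) := fun t ht =>
    (hderiv t ht).differentiableWithinAt
  have hineq : ∀ c : ℝ, 0 < c → c < 1 → ∀ t ∈ Set.Icc 0 T,
      derivWithin H (Set.Icc 0 T) t
        ≤ -2 * (1 - c) * Real.exp (-(Real.exp (-t) * B)) * lam * H t
          + SHK.forcing Δgrad S R₀ R₀' c t := by
    intro c hc0 hc1 t ht
    have het := Real.exp_pos (-t)
    rw [(hderiv t ht).derivWithin (uniqueDiffOn_Icc hT t ht),
      SHK.kl_deriv_eq hΘ hρ hρ' hV hV' hVinv hVinv' ht]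
    have h1 := SHK.transport_le hΘ hρ hρ' hV hV' hVinv ht hc0 hgrad
    have h2 := SHK.birthDeath_le hΘ hρ hρ' hV hV' hVinv hVinv' ht (hdecay t ht) (hdecay' t ht) hS
    have h3 := SHK.kl_le_fisher hΘ hρ hρ' hV hV' hVinv hVinv' ht hlam hLSI'
      (a := Real.exp (-t) * B)
      fun x y => (hdecay' t ht x y).trans (mul_le_mul_of_nonneg_left hRB' het.le)
    rw [← hH t] at h3
    -- the fraction `1 - c` of the Fisher information left over by the transport part
    have h4 := mul_le_mul_of_nonneg_left h3 (sub_pos.2 hc1).le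
    have h5 : (Real.exp (-t) * R₀') ^ 2 = R₀' ^ 2 * Real.exp (-2 * t) := by
      rw [mul_pow, ← Real.exp_nat_mul, mul_comm]
      congr 2
      push_cast
      ring
    rw [h5] at h2
    have h6 : 0 ≤ R₀' * Real.exp (-t) := mul_nonneg hR₀0' het.le
    rw [SHK.forcing]
    linarith
  have hH0 : H 0 ≤ 0 := by
    have : ∀ x, Real.log (ρ' 0 x / ρ' 0 x) = 0 := fun x => by
      rw [div_self (hρ'.ne_zero h0 x), Real.log_one]
    rw [hH, SHK.kl, hinit]
    simp [this]
  have hint : ∀ c : ℝ, 0 < c → c < 1 → ∀ t ∈ Set.Icc 0 T,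
      H t ≤ ∫ s in (0 : ℝ)..t,
        Real.exp (-2 * (1 - c) * lam * ∫ u in s..t, Real.exp (-(Real.exp (-u) * B)))
          * SHK.forcing Δgrad S R₀ R₀' c s := by
    intro c hc0 hc1 t ht
    have h := SHK.le_integral_of_derivWithin_le (T := T) (H := H)
      (a := fun u => 2 * (1 - c) * lam * Real.exp (-(Real.exp (-u) * B)))
      (b := SHK.forcing Δgrad S R₀ R₀' c) (by fun_prop) (by unfold SHK.forcing; fun_prop) hdiff
      (fun s hs => (hineq c hc0 hc1 s hs).trans_eq (by ring)) hH0 ht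
    simp only [intervalIntegral.integral_const_mul] at h
    simpa only [neg_mul] using h
  refine ⟨⟨hdiff, hineq⟩, hint, ?_, ?_, ?_⟩
  · rintro c hc0 hc1 A₁ A₂ A₃ κ rfl rfl rfl hκ t ht
    have hκ0 : κ ≠ 0 := by
      have := sub_pos.2 hc1
      rw [hκ]
      positivity
    have hb := (hint c hc0 hc1 t ht).trans (SHK.integral_forcing_le (Δ := Δgrad) hB hRB hR₀0' hRB'
      hS0 hR₀0 hc0 hc1 hlam hκ ht.1)
    rw [SHK.integral_exp_mul_exp hκ0] at hb
    simp only [neg_zero, zero_mul, Real.exp_zero, sub_zero] at hb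
    refine ⟨fun h1 h2 => ?_, fun h1 => ?_, fun h2 => ?_⟩
    · rw [SHK.integral_exp_mul_exp h1, SHK.integral_exp_mul_exp h2] at hb
      simpa only [neg_one_mul] using hb
    · rw [SHK.integral_exp_mul_exp (m := 2) (by rw [h1]; norm_num)] at hb
      subst h1
      rw [SHK.integral_exp_mul_exp_self] at hb
      simpa only [neg_one_mul] using hb
    · rw [SHK.integral_exp_mul_exp (m := 1) (by rw [h2]; norm_num)] at hb
      subst h2
      rw [SHK.integral_exp_mul_exp_self] at hb
      simpa only [neg_one_mul] using hb
  · intro Δpot hΔ x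
    have h := SHK.abs_log_gibbs_div_le hΘ hV.continuous hV'.continuous
      (fun y => (abs_le.1 (hΔ y)).1) (fun y => (abs_le.1 (hΔ y)).2) x
    linarith
  · intro Δosc hΔ x
    have hc : Continuous fun x => V x - V' x := hV.continuous.sub hV'.continuous
    have hinv : SHK.IsInvariant Γ fun x => V x - V' x := fun γ hγ y => by
      simp only [hVinv γ hγ, hVinv' γ hγ]
    exact (SHK.abs_log_gibbs_div_le hΘ hV.continuous hV'.continuous
      (fun y => ciInf_le (hΘ.bddBelow_range hc hinv) y)
      (fun y => le_ciSup (hΘ.bddAbove_range hc hinv) y) x).trans hΔ
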